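/- **Theorem (Convergence).** Let $T,L>0$ and let $E:[0,T]\times\mathbb R\to\mathbb C$, $N,V:[0,T]\times\mathbb R\to\mathbb R$ be $L$-periodic in $x$, of class $C^5$ jointly in $(t,x)$ on $[0,T]\times\mathbb R$, and a solution of the Zakharov system $$\mathrm i E_t+E_{xx}=NE,\qquad N_t=V_{xx},\qquad V_t=N+|E|^2\qquad(0<t<T,\ x\in\mathbb R),\qquad V(0,0)=0.$$ For positive integers $M,K$ put $\Delta t=T/M$, $\Delta x=L/K$ and, for mesh functions, $$\delta_x^+v_k=\tfrac{v_{k+1}-v_k}{\Delta x},\quad \delta_x^{\langle2\rangle}v_k=\tfrac{v_{k+1}-2v_k+v_{k-1}}{(\Delta x)^2},\quad \delta_t^+u^{(m)}_k=\tfrac{u^{(m+1)}_k-u^{(m)}_k}{\Delta t},\quad \mu_t^+u^{(m)}_k=\tfrac{u^{(m+1)}_k+u^{(m)}_k}{2},\quad \|v\|=\Big(\sum_{k=1}^K|v_k|^2\Delta x\Big)^{1/2}.$$ Let $C_V>0$. Then there are constants $C>0$ and $\varepsilon>0$, not depending on $\Delta t$ and $\Delta x$, such that the following holds whenever $\Delta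 t<\varepsilon$ and $\Delta x<\varepsilon$ (no relation between $\Delta t$ and $\Delta x$ is required). Let $E^{(m)}_k\in\mathbb C$ and $N^{(m)}_k,V^{(m)}_k\in\mathbb R$ ($0\le m\le M$, $k\in\mathbb Z$) be $K$-periodic in $k$ and solve the discrete variational derivative (DVDM) scheme $$\mathrm i\,\delta_t^+E^{(m)}_k=-\delta_x^{\langle2\rangle}\mu_t^+E^{(m)}_k+(\mu_t^+N^{(m)}_k)(\mu_t^+E^{(m)}_k),\qquad \delta_t^+N^{(m)}_k=\delta_x^{\langle2\rangle}\mu_t^+V^{(m)}_k,\qquad \delta_t^+V^{(m)}_k=\mu_t^+N^{(m)}_k+\mu_t^+|E^{(m)}_k|^2$$ for $0\le m<M$, with initial values $E^{(0)}_k=E(0,k\Delta x)$, $N^{(0)}_k=N(0,k\Delta x)$ and $V^{(0)}$ satisfying $\|\delta_x^+(V^{(0)}_k-V(0,k\Delta x))_k\|\le C_V(\Delta x)^2$ (for instance $V^{(0)}_k=V(0,k\Delta x)$). Then, for every $m=0,\dots,M$, the errors $e_{E,k}^{(m)}=E^{(m)}_k-E(m\Delta t,k\Delta x)$, $e_{N,k}^{(m)}=N^{(m)}_k-N(m\Delta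 t,k\Delta x)$, $e_{V,k}^{(m)}=V^{(m)}_k-V(m\Delta t,k\Delta x)$ satisfy $$\|e_E^{(m)}\|^2+\|\delta_x^+e_E^{(m)}\|^2+\|e_N^{(m)}\|^2+\|\delta_x^+e_V^{(m)}\|^2\le C^2\big((\Delta t)^2+(\Delta x)^2\big)^2 .$$ In particular, $$\|e_E^{(m)}\|,\ \|\delta_x^+e_E^{(m)}\|,\ \|e_N^{(m)}\|,\ \|\delta_x^+e_V^{(m)}\|\ \le\ C\big((\Delta t)^2+(\Delta x)^2\big).$$ -/

import Mathlib

noncomputable section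

namespace Zakharov

/-! ### Difference operators, averages and norms on mesh functions -/

section Discrete

variable {F : Type*} [NormedAddCommGroup F] [NormedSpace ℝ F]

/-- Spatial forward difference `δ⁺ₓ v_k = (v_{k+1} - v_k) / Δx`. -/
def dxPlus (dx : ℝ) (v : ℤ → F) (k : ℤ) : F :=
  dx⁻¹ • (v (k + 1) - v k)

/-- Spatial second order central difference
`δ²ₓ v_k = (v_{k+1} - 2 v_k + v_{k-1}) / (Δx)²`. -/
def dxTwo (dx : ℝ) (v : ℤ → F) (k : ℤ) : F :=
  (dx ^ 2)⁻¹ • (v (k + 1) - (2 : ℝ) • v k + v (k - 1))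

/-- Temporal forward difference `δ⁺ₜ u^{(m)}_k = (u^{(m+1)}_k - u^{(m)}_k) / Δt`. -/
def dtPlus (dt : ℝ) (u : ℕ → ℤ → F) (m : ℕ) (k : ℤ) : F :=
  dt⁻¹ • (u (m + 1) k - u m k)

/-- Temporal forward average `μ⁺ₜ u^{(m)}_k = (u^{(m+1)}_k + u^{(m)}_k) / 2`. -/
def mtPlus (u : ℕ → ℤ → F) (m : ℕ) (k : ℤ) : F :=
  (2 : ℝ)⁻¹ • (u (m + 1) k + u m k)

/-- Discrete `L²` norm `‖v‖ = (∑_{k=1}^K |v_k|² Δx)^{1/2}` of a `K`-periodic mesh function. -/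
def meshNorm (dx : ℝ) (K : ℕ) (v : ℤ → F) : ℝ :=
  Real.sqrt (∑ k ∈ Finset.Icc (1 : ℤ) (K : ℤ), ‖v k‖ ^ 2 * dx)

/-- The mesh values `f(m Δt, k Δx)` of a function `f(t, x)`. -/
def sample (dt dx : ℝ) (f : ℝ → ℝ → F) (m : ℕ) (k : ℤ) : F :=
  f ((m : ℝ) * dt) ((k : ℝ) * dx)

end Discrete

/-! ### The Zakharov system -/

/-- `(E, N, V)` is an `L`-periodic solution, on the time interval `[0, T]`, of
`i E_t + E_xx = N E`, `N_t = V_xx`, `V_t = N + |E|²`, `V(0,0) = 0`. -/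
structure IsSolution (T L : ℝ) (E : ℝ → ℝ → ℂ) (N V : ℝ → ℝ → ℝ) : Prop where
  periodic_E : ∀ t ∈ Set.Icc 0 T, ∀ x, E t (x + L) = E t x
  periodic_N : ∀ t ∈ Set.Icc 0 T, ∀ x, N t (x + L) = N t x
  periodic_V : ∀ t ∈ Set.Icc 0 T, ∀ x, V t (x + L) = V t x
  eq_E : ∀ t ∈ Set.Ioo 0 T, ∀ x,
    Complex.I * deriv (fun s => E s x) t + iteratedDeriv 2 (E t) x = (N t x : ℂ) * E t x
  eq_N : ∀ t ∈ Set.Ioo 0 T, ∀ x, deriv (fun s => N s x) t = iteratedDeriv 2 (V t) x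
  eq_V : ∀ t ∈ Set.Ioo 0 T, ∀ x, deriv (fun s => V s x) t = N t x + ‖E t x‖ ^ 2
  V_zero : V 0 0 = 0

/-- `f(t, x)` is of class `C^n` jointly in `(t, x)` on the closed strip `[0, T] × ℝ`. -/
def SmoothOnStrip {F : Type*} [NormedAddCommGroup F] [NormedSpace ℝ F]
    (n : ℕ) (T : ℝ) (f : ℝ → ℝ → F) : Prop :=
  ContDiffOn ℝ n (fun p : ℝ × ℝ => f p.1 p.2) (Set.Icc 0 T ×ˢ Set.univ)

/-! ### The DVDM scheme -/

/-- `(Eₕ, Nₕ, Vₕ)`, with `Eₕ m k` standing for `E^{(m)}_k`, is a `K`-periodic solution of the DVDM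
scheme for the time levels `0, …, M`. -/
structure IsDVDM (dt dx : ℝ) (M K : ℕ) (Eₕ : ℕ → ℤ → ℂ) (Nₕ Vₕ : ℕ → ℤ → ℝ) : Prop where
  periodic_E : ∀ m ≤ M, ∀ k, Eₕ m (k + K) = Eₕ m k
  periodic_N : ∀ m ≤ M, ∀ k, Nₕ m (k + K) = Nₕ m k
  periodic_V : ∀ m ≤ M, ∀ k, Vₕ m (k + K) = Vₕ m k
  eq_E : ∀ m < M, ∀ k,
    Complex.I * dtPlus dt Eₕ m k
      = -dxTwo dx (mtPlus Eₕ m) k + ((mtPlus Nₕ m k : ℝ) : ℂ) * mtPlus Eₕ m k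
  eq_N : ∀ m < M, ∀ k, dtPlus dt Nₕ m k = dxTwo dx (mtPlus Vₕ m) k
  eq_V : ∀ m < M, ∀ k,
    dtPlus dt Vₕ m k = mtPlus Nₕ m k + mtPlus (fun j l => ‖Eₕ j l‖ ^ 2) m k

/-- The error functional
`‖e_E‖² + ‖δ⁺ₓ e_E‖² + ‖e_N‖² + ‖δ⁺ₓ e_V‖²` of mesh functions `e_E`, `e_N`, `e_V`. -/
def errorFunctional (dx : ℝ) (K : ℕ) (eE : ℤ → ℂ) (eN eV : ℤ → ℝ) : ℝ :=
  meshNorm dx K eE ^ 2 + meshNorm dx K (dxPlus dx eE) ^ 2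
    + meshNorm dx K eN ^ 2 + meshNorm dx K (dxPlus dx eV) ^ 2

end Zakharov

end

noncomputable section

namespace Zakharov

/-! ### Sums over one period -/

/-! The proof is a relative-energy argument. The scheme conserves the mass `‖E‖²` and a discrete
energy with density `|δE|² + N²/2 + (δV)²/2 + N|E|²`, since averages and increments in time satisfy
an exact product rule. Write `w`, `p` for the sampled exact `E`, `N` and `a`, `n`, `v` for the
errors. `energyDensity` is the energy at exact plus error, minus its value and its first variation
at the exact solution: a quadratic form in the error plus the cubic term `n|a|²`.
`IsPerturbedStep.energy_identity` shows that its increment over a step involves only the residuals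
of the exact solution and the time differences of `w` and `p`.

Two difficulties remain. The cubic term needs a sup bound on `a` that is uniform in the mesh. With
zero reference and zero residuals the same identities are the conservation laws of the scheme;
together with the one-dimensional Gagliardo–Nirenberg inequality they bound the discrete `E`
(`sq_norm_le_of_steps`). The error thus needs no smallness bootstrap, and no relation between the
two mesh sizes enters. The relative energy is also indefinite; adding a large multiple of the mass
of `a`, whose growth `IsPerturbedStep.mass_identity` controls, makes it coercive
(`errorDensity_le_lyapunov`).

The resulting functional satisfies an implicit Gronwall inequality
(`IsPerturbedStep.lyapunov_sub_le`, `discrete_gronwall`) with the squared residuals as source. The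
residuals are second order by Taylor expansion about the temporal midpoint
(`IsSolution.exists_residual_le`). Summation by parts puts a difference on the residuals of the `E`
and `V` equations, so these are estimated together with their spatial differences; the fourth
`x`-derivative of `E` must then be Lipschitz, which accounts for five derivatives. -/

theorem sum_Icc_int (K : ℕ) (f : ℤ → ℝ) :
    ∑ k ∈ Finset.Icc (1 : ℤ) (K : ℤ), f k = ∑ i ∈ Finset.range K, f ((i : ℤ) + 1) := by
  induction K with
  | zero => simp
  | succ K ih =>
    rw [Finset.sum_range_succ, ← ih]
    have : Finset.Icc (1 : ℤ) ((K + 1 : ℕ) : ℤ)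
        = insert ((K : ℤ) + 1) (Finset.Icc (1 : ℤ) (K : ℤ)) := by
      ext x; simp only [Finset.mem_Icc, Finset.mem_insert]; push_cast; omega
    rw [this, Finset.sum_insert (by simp), add_comm]

/-- The weighted sum `∑_{k=1}^K g_k Δx`. -/
def meshSum (dx : ℝ) (K : ℕ) (g : ℤ → ℝ) : ℝ :=
  ∑ k ∈ Finset.Icc (1 : ℤ) (K : ℤ), g k * dx

section

variable {dx : ℝ} {K : ℕ}

theorem meshSum_add (f g : ℤ → ℝ) :
    meshSum dx K (fun k => f k + g k) = meshSum dx K f + meshSum dx K g := by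
  simp [meshSum, add_mul, Finset.sum_add_distrib]

theorem meshSum_sub (f g : ℤ → ℝ) :
    meshSum dx K (fun k => f k - g k) = meshSum dx K f - meshSum dx K g := by
  simp [meshSum, sub_mul, Finset.sum_sub_distrib]

theorem meshSum_const_mul (c : ℝ) (f : ℤ → ℝ) :
    meshSum dx K (fun k => c * f k) = c * meshSum dx K f := by
  simp [meshSum, Finset.mul_sum, mul_assoc]

theorem meshSum_const (c : ℝ) : meshSum dx K (fun _ => c) = K * dx * c := by
  simp [meshSum]; ring

theorem meshSum_mono (hdx : 0 ≤ dx) {f g : ℤ → ℝ}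
    (h : ∀ k ∈ Finset.Icc (1 : ℤ) (K : ℤ), f k ≤ g k) : meshSum dx K f ≤ meshSum dx K g :=
  Finset.sum_le_sum fun k hk => mul_le_mul_of_nonneg_right (h k hk) hdx

theorem meshSum_nonneg (hdx : 0 ≤ dx) {f : ℤ → ℝ} (h : ∀ k, 0 ≤ f k) : 0 ≤ meshSum dx K f :=
  Finset.sum_nonneg fun k _ => mul_nonneg (h k) hdx

/-- The difference of the two sums telescopes to `f (K + 1) - f 1`, which vanishes by periodicity.
-/
theorem meshSum_shift {f : ℤ → ℝ} (hf : ∀ k, f (k + K) = f k) :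
    meshSum dx K (fun k => f (k + 1)) = meshSum dx K f := by
  have h := Finset.sum_range_sub (fun i : ℕ => f ((i : ℤ) + 1)) K
  have h1 := hf 1
  rw [add_comm] at h1
  simp only [Nat.cast_zero, zero_add, h1, sub_self, Finset.sum_sub_distrib, sub_eq_zero] at h
  unfold meshSum
  rw [← Finset.sum_mul, ← Finset.sum_mul, sum_Icc_int, sum_Icc_int, ← h]
  push_cast; rfl

theorem meshNorm_sq {F : Type*} [NormedAddCommGroup F] [NormedSpace ℝ F] (hdx : 0 ≤ dx)
    (v : ℤ → F) : meshNorm dx K v ^ 2 = meshSum dx K (fun k => ‖v k‖ ^ 2) :=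
  Real.sq_sqrt (Finset.sum_nonneg fun _ _ => mul_nonneg (sq_nonneg _) hdx)

/-- Summation by parts. -/
theorem meshSum_mul_dxTwo {b u : ℤ → ℝ} (hb : ∀ k, b (k + K) = b k)
    (hu : ∀ k, u (k + K) = u k) :
    meshSum dx K (fun k => b k * dxTwo dx u k)
      = -meshSum dx K (fun k => dxPlus dx b k * dxPlus dx u k) := by
  -- The shift increment of `b_k (u_k - u_{k-1}) / Δx²` is exactly `b δ²u + δb δu`, by the discrete
  -- product rule.
  have h := meshSum_shift (dx := dx) (K := K)
    (f := fun k : ℤ => (dx ^ 2)⁻¹ * (b k * (u k - u (k - 1)))) fun k => by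
      have h2 : u (k + K - 1) = u (k - 1) := by
        rw [show k + (K : ℤ) - 1 = k - 1 + K by ring, hu]
      simp only [hb, hu, h2]
  rw [← sub_eq_zero, ← meshSum_sub] at h
  rw [eq_neg_iff_add_eq_zero, ← meshSum_add, ← h]
  congr 1
  funext k
  simp only [dxTwo, dxPlus, smul_eq_mul, add_sub_cancel_right]
  ring

/-- Cauchy–Schwarz, with the weight split as `√dx · √dx`. -/
theorem meshSum_mul_le (hdx : 0 ≤ dx) (f g : ℤ → ℝ) :
    meshSum dx K (fun k => f k * g k)
      ≤ √(meshSum dx K (fun k => f k ^ 2)) * √(meshSum dx K (fun k => g k ^ 2)) := by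
  have h := Real.sum_mul_le_sqrt_mul_sqrt (Finset.Icc (1 : ℤ) (K : ℤ))
    (fun k => f k * √dx) (fun k => g k * √dx)
  simp only [mul_pow, Real.sq_sqrt hdx] at h
  refine le_trans (le_of_eq ?_) h
  refine Finset.sum_congr rfl fun k _ => ?_
  linear_combination -(f k * g k) * Real.mul_self_sqrt hdx

/-- The oscillation of a periodic mesh function is bounded by its total variation. -/
theorem sub_le_sum_abs {f : ℤ → ℝ} {i j : ℤ} (hi : i ∈ Finset.Icc (1 : ℤ) (K : ℤ))
    (hj : j ∈ Finset.Icc (1 : ℤ) (K : ℤ)) :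
    f j - f i ≤ ∑ k ∈ Finset.Icc (1 : ℤ) (K : ℤ), |f (k + 1) - f k| := by
  have key : ∀ (n : ℕ) (i : ℤ), |f (i + n) - f i| ≤ ∑ k ∈ Finset.Ico i (i + n), |f (k + 1) - f k| := by
    intro n i
    induction n with
    | zero => simp
    | succ n ih =>
      have : Finset.Ico i (i + (n + 1 : ℕ)) = insert (i + (n : ℤ)) (Finset.Ico i (i + n)) := by
        ext x; simp only [Finset.mem_Ico, Finset.mem_insert]; push_cast; omega
      rw [this, Finset.sum_insert (by simp)]
      refine (abs_sub_le _ (f (i + n)) _).trans ?_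
      push_cast
      rw [← add_assoc]
      gcongr
  simp only [Finset.mem_Icc] at hi hj
  have sub : ∀ i j : ℤ, 1 ≤ i → j ≤ K → ∑ k ∈ Finset.Ico i j, |f (k + 1) - f k|
      ≤ ∑ k ∈ Finset.Icc (1 : ℤ) (K : ℤ), |f (k + 1) - f k| := fun i j hi hj =>
    Finset.sum_le_sum_of_subset_of_nonneg
      (fun x hx => by simp only [Finset.mem_Ico, Finset.mem_Icc] at hx ⊢; omega)
      (fun _ _ _ => abs_nonneg _)
  rcases le_total i j with h | h
  · obtain ⟨n, rfl⟩ := Int.le.dest h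
    exact (le_abs_self _).trans ((key n i).trans (sub _ _ hi.1 hj.2))
  · obtain ⟨n, rfl⟩ := Int.le.dest h
    exact (le_abs_self _).trans ((abs_sub_comm _ _).le.trans ((key n j).trans (sub _ _ hj.1 hi.2)))

/-- Discrete Gagliardo–Nirenberg inequality. -/
theorem sq_norm_le_of_periodic {F : Type*} [NormedAddCommGroup F] [NormedSpace ℝ F]
    (hdx : 0 < dx) (hK : 0 < K) {v : ℤ → F} (hv : ∀ k, v (k + K) = v k) {j : ℤ}
    (hj : j ∈ Finset.Icc (1 : ℤ) (K : ℤ)) :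
    ‖v j‖ ^ 2 ≤ (K * dx)⁻¹ * meshSum dx K (fun k => ‖v k‖ ^ 2)
      + 2 * (√(meshSum dx K (fun k => ‖v k‖ ^ 2))
        * √(meshSum dx K (fun k => ‖dxPlus dx v k‖ ^ 2))) := by
  have hKdx : 0 < (K : ℝ) * dx := by positivity
  have hosc : ∀ i ∈ Finset.Icc (1 : ℤ) (K : ℤ), ‖v j‖ ^ 2 - 2 * (√(meshSum dx K (fun k => ‖v k‖ ^ 2))
        * √(meshSum dx K (fun k => ‖dxPlus dx v k‖ ^ 2))) ≤ ‖v i‖ ^ 2 := by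
    intro i hi
    have h1 := sub_le_sum_abs (f := fun k => ‖v k‖ ^ 2) hi hj
    have h2 : ∑ k ∈ Finset.Icc (1 : ℤ) (K : ℤ), |‖v (k + 1)‖ ^ 2 - ‖v k‖ ^ 2|
        ≤ meshSum dx K (fun k => ‖v (k + 1)‖ * ‖dxPlus dx v k‖)
          + meshSum dx K (fun k => ‖v k‖ * ‖dxPlus dx v k‖) := by
      rw [← meshSum_add]
      refine Finset.sum_le_sum fun k _ => ?_
      have e1 : ‖dxPlus dx v k‖ * dx = ‖v (k + 1) - v k‖ := by
        rw [dxPlus, norm_smul, norm_inv, Real.norm_of_nonneg hdx.le]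
        field_simp
      have e2 : (‖v (k + 1)‖ * ‖dxPlus dx v k‖ + ‖v k‖ * ‖dxPlus dx v k‖) * dx
          = (‖v (k + 1)‖ + ‖v k‖) * ‖v (k + 1) - v k‖ := by rw [← e1]; ring
      rw [e2, sq_sub_sq, abs_mul, abs_of_nonneg (by positivity)]
      exact mul_le_mul_of_nonneg_left (abs_norm_sub_norm_le _ _) (by positivity)
    have h3 := meshSum_mul_le (K := K) hdx.le (fun k => ‖v (k + 1)‖) (fun k => ‖dxPlus dx v k‖)
    have h4 := meshSum_mul_le (K := K) hdx.le (fun k => ‖v k‖) (fun k => ‖dxPlus dx v k‖)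
    -- Periodicity lets the factor at `k + 1` be measured by the same norm as the factor at `k`, so
    -- both products have the same bound.
    rw [meshSum_shift (f := fun k => ‖v k‖ ^ 2) (fun k => by simp [hv])] at h3
    linarith
  -- Averaging over `i` replaces `‖v i‖ ^ 2` by its mean, which is the term with `(K * dx)⁻¹`.
  have := meshSum_mono (K := K) hdx.le hosc
  rw [meshSum_const] at this
  rw [← sub_le_iff_le_add, inv_mul_eq_div, le_div_iff₀ hKdx]
  linarith

end

/-! ### The energy identity of a perturbed step -/

/-- One step of the perturbed scheme for the deviation `(a, n, v)` from a reference `(w, p, ·)`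
that satisfies the scheme up to the residuals `rE`, `rN`, `rV`. -/
structure IsPerturbedStep (dt dx : ℝ) (K m : ℕ) (a w : ℕ → ℤ → ℂ) (n v p : ℕ → ℤ → ℝ)
    (rE : ℤ → ℂ) (rN rV : ℤ → ℝ) : Prop where
  periodic_a : ∀ k, a m (k + K) = a m k
  periodic_a_succ : ∀ k, a (m + 1) (k + K) = a (m + 1) k
  periodic_v : ∀ k, v m (k + K) = v m k
  periodic_v_succ : ∀ k, v (m + 1) (k + K) = v (m + 1) k
  periodic_rE : ∀ k, rE (k + K) = rE k
  periodic_rV : ∀ k, rV (k + K) = rV k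
  eq_a : ∀ k, Complex.I * dtPlus dt a m k
    = -dxTwo dx (mtPlus a m) k + ((mtPlus p m k + mtPlus n m k : ℝ) : ℂ) * mtPlus a m k
      + ((mtPlus n m k : ℝ) : ℂ) * mtPlus w m k - rE k
  eq_n : ∀ k, dtPlus dt n m k = dxTwo dx (mtPlus v m) k - rN k
  eq_v : ∀ k, dtPlus dt v m k = mtPlus n m k
    + mtPlus (fun j l => ‖a j l‖ ^ 2 + 2 * ((w j l).re * (a j l).re + (w j l).im * (a j l).im)) m k
      - rV k

/-- The density of the relative energy. -/
def energyDensity (dx : ℝ) (a w : ℤ → ℂ) (n v p : ℤ → ℝ) (k : ℤ) : ℝ :=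
  ‖dxPlus dx a k‖ ^ 2 + n k ^ 2 / 2 + dxPlus dx v k ^ 2 / 2 + n k * ‖a k‖ ^ 2
    + 2 * n k * ((w k).re * (a k).re + (w k).im * (a k).im) + p k * ‖a k‖ ^ 2

/-- The density of the rate of change of the relative energy. -/
def energyRate (dt dx : ℝ) (a w : ℕ → ℤ → ℂ) (n v p : ℕ → ℤ → ℝ)
    (rE : ℤ → ℂ) (rN rV : ℤ → ℝ) (m : ℕ) (k : ℤ) : ℝ :=
  -2 * ((dxPlus dx rE k).im * (dxPlus dx (mtPlus a m) k).re
      - (dxPlus dx rE k).re * (dxPlus dx (mtPlus a m) k).im)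
    - 2 * (rE k * (starRingEnd ℂ) (((mtPlus p m k + mtPlus n m k : ℝ) : ℂ) * mtPlus a m k
      + ((mtPlus n m k : ℝ) : ℂ) * mtPlus w m k)).im
    - dxPlus dx rV k * dxPlus dx (mtPlus v m) k
    - rN k * (mtPlus n m k + mtPlus (fun j l => ‖a j l‖ ^ 2
      + 2 * ((w j l).re * (a j l).re + (w j l).im * (a j l).im)) m k)
    + 2 * mtPlus n m k * ((dtPlus dt w m k).re * (mtPlus a m k).re
      + (dtPlus dt w m k).im * (mtPlus a m k).im)
    + dtPlus dt p m k * mtPlus (fun j l => ‖a j l‖ ^ 2) m k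

theorem sq_norm_complex (z : ℂ) : ‖z‖ ^ 2 = z.re ^ 2 + z.im ^ 2 := by
  rw [Complex.sq_norm, Complex.normSq_apply]; ring

theorem dxTwo_re (dx : ℝ) (u : ℤ → ℂ) (k : ℤ) :
    (dxTwo dx u k).re = dxTwo dx (fun k => (u k).re) k := by
  simp [dxTwo, -Complex.ofReal_inv, -Complex.ofReal_pow]; ring

theorem dxTwo_im (dx : ℝ) (u : ℤ → ℂ) (k : ℤ) :
    (dxTwo dx u k).im = dxTwo dx (fun k => (u k).im) k := by
  simp [dxTwo, -Complex.ofReal_inv, -Complex.ofReal_pow]; ring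

theorem dxPlus_re (dx : ℝ) (u : ℤ → ℂ) (k : ℤ) :
    (dxPlus dx u k).re = dxPlus dx (fun k => (u k).re) k := by
  simp [dxPlus]

theorem dxPlus_im (dx : ℝ) (u : ℤ → ℂ) (k : ℤ) :
    (dxPlus dx u k).im = dxPlus dx (fun k => (u k).im) k := by
  simp [dxPlus]

section

variable {dt dx : ℝ} {K m : ℕ} {a w : ℕ → ℤ → ℂ} {n v p : ℕ → ℤ → ℝ}
  {rE : ℤ → ℂ} {rN rV : ℤ → ℝ}

theorem dtPlus_re (dt : ℝ) (u : ℕ → ℤ → ℂ) (m : ℕ) (k : ℤ) :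
    (dtPlus dt u m k).re = dtPlus dt (fun m k => (u m k).re) m k := by
  simp [dtPlus]

theorem dtPlus_im (dt : ℝ) (u : ℕ → ℤ → ℂ) (m : ℕ) (k : ℤ) :
    (dtPlus dt u m k).im = dtPlus dt (fun m k => (u m k).im) m k := by
  simp [dtPlus]

theorem mtPlus_re (u : ℕ → ℤ → ℂ) (m : ℕ) (k : ℤ) :
    (mtPlus u m k).re = 2⁻¹ * ((u (m + 1) k).re + (u m k).re) := by
  simp [mtPlus]; ring

theorem mtPlus_im (u : ℕ → ℤ → ℂ) (m : ℕ) (k : ℤ) :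
    (mtPlus u m k).im = 2⁻¹ * ((u (m + 1) k).im + (u m k).im) := by
  simp [mtPlus]; ring

theorem mtPlus_periodic {F : Type*} [NormedAddCommGroup F] [NormedSpace ℝ F] {u : ℕ → ℤ → F}
    (h0 : ∀ k, u m (k + K) = u m k) (h1 : ∀ k, u (m + 1) (k + K) = u (m + 1) k) (k : ℤ) :
    mtPlus u m (k + K) = mtPlus u m k := by
  simp [mtPlus, h0, h1]

/-- The increment of a discrete Dirichlet integral. -/
theorem meshSum_sq_dxPlus_sub {u : ℕ → ℤ → ℝ} (h0 : ∀ k, u m (k + K) = u m k)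
    (h1 : ∀ k, u (m + 1) (k + K) = u (m + 1) k) :
    meshSum dx K (fun k => dxPlus dx (u (m + 1)) k ^ 2 - dxPlus dx (u m) k ^ 2)
      = meshSum dx K (fun k => -2 * ((u (m + 1) k - u m k) * dxTwo dx (mtPlus u m) k)) := by
  rw [meshSum_const_mul, meshSum_mul_dxTwo (fun k => by rw [h0, h1]) (mtPlus_periodic h0 h1),
    neg_mul_neg, ← meshSum_const_mul]
  congr 1; funext k
  simp only [dxPlus, mtPlus, smul_eq_mul]; ring

theorem IsPerturbedStep.eq_re (h : IsPerturbedStep dt dx K m a w n v p rE rN rV) (hdt : dt ≠ 0)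
    (k : ℤ) : (a (m + 1) k).im - (a m k).im = dt * ((dxTwo dx (mtPlus a m) k).re
      - (mtPlus p m k + mtPlus n m k) * (mtPlus a m k).re
      - mtPlus n m k * (mtPlus w m k).re + (rE k).re) := by
  have := congrArg Complex.re (h.eq_a k)
  simp only [Complex.mul_re, Complex.I_re, Complex.I_im, Complex.sub_re, Complex.add_re,
    Complex.neg_re, Complex.ofReal_re, Complex.ofReal_im, dtPlus_im, dtPlus_re] at this
  simp only [dtPlus, smul_eq_mul] at this
  field_simp at this
  linear_combination -this

theorem IsPerturbedStep.eq_im (h : IsPerturbedStep dt dx K m a w n v p rE rN rV) (hdt : dt ≠ 0)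
    (k : ℤ) : (a (m + 1) k).re - (a m k).re = dt * (-(dxTwo dx (mtPlus a m) k).im
      + (mtPlus p m k + mtPlus n m k) * (mtPlus a m k).im
      + mtPlus n m k * (mtPlus w m k).im - (rE k).im) := by
  have := congrArg Complex.im (h.eq_a k)
  simp only [Complex.mul_im, Complex.I_re, Complex.I_im, Complex.sub_im, Complex.add_im,
    Complex.neg_im, Complex.ofReal_re, Complex.ofReal_im, dtPlus_im, dtPlus_re] at this
  simp only [dtPlus, smul_eq_mul] at this
  field_simp at this
  linear_combination this

/-- Test the equation for `a` with the conjugate of its average. The Laplacian contributes nothing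
after summation by parts and the potential is real, so only the coupling to the reference and the
residual survive in the imaginary part. -/
theorem IsPerturbedStep.mass_identity (h : IsPerturbedStep dt dx K m a w n v p rE rN rV)
    (hdt : dt ≠ 0) :
    meshSum dx K (fun k => ‖a (m + 1) k‖ ^ 2) - meshSum dx K (fun k => ‖a m k‖ ^ 2)
      = dt * meshSum dx K (fun k => 2 * ((((mtPlus n m k : ℝ) : ℂ) * mtPlus w m k - rE k)
        * (starRingEnd ℂ) (mtPlus a m k)).im) := by
  have hper := mtPlus_periodic h.periodic_a h.periodic_a_succ
  have h1 := meshSum_mul_dxTwo (dx := dx) (K := K) (b := fun k => (mtPlus a m k).re)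
    (u := fun k => (mtPlus a m k).im) (fun k => by simp only [hper]) (fun k => by simp only [hper])
  have h2 := meshSum_mul_dxTwo (dx := dx) (K := K) (b := fun k => (mtPlus a m k).im)
    (u := fun k => (mtPlus a m k).re) (fun k => by simp only [hper]) (fun k => by simp only [hper])
  have h3 : meshSum dx K (fun k => (mtPlus a m k).re * (dxTwo dx (mtPlus a m) k).im
      - (mtPlus a m k).im * (dxTwo dx (mtPlus a m) k).re) = 0 := by
    simp only [meshSum_sub, dxTwo_re, dxTwo_im, h1, h2]
    simp only [mul_comm]; ring
  rw [← meshSum_const_mul, ← meshSum_sub]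
  have h4 : ∀ k, ‖a (m + 1) k‖ ^ 2 - ‖a m k‖ ^ 2
      = dt * (2 * ((((mtPlus n m k : ℝ) : ℂ) * mtPlus w m k - rE k)
        * (starRingEnd ℂ) (mtPlus a m k)).im)
      - 2 * dt * ((mtPlus a m k).re * (dxTwo dx (mtPlus a m) k).im
      - (mtPlus a m k).im * (dxTwo dx (mtPlus a m) k).re) := by
    intro k
    have e1 := h.eq_re hdt k
    have e2 := h.eq_im hdt k
    have r1 := mtPlus_re a m k
    have r2 := mtPlus_im a m k
    simp only [sq_norm_complex, Complex.mul_im, Complex.conj_re, Complex.conj_im, Complex.sub_im,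
      Complex.sub_re, Complex.mul_re, Complex.ofReal_re, Complex.ofReal_im]
    linear_combination 2 * (mtPlus a m k).im * e1 + 2 * (mtPlus a m k).re * e2
      - 2 * ((a (m + 1) k).re - (a m k).re) * r1 - 2 * ((a (m + 1) k).im - (a m k).im) * r2
  simp only [h4]
  rw [meshSum_sub, meshSum_const_mul (2 * dt), h3, mul_zero, sub_zero]

/-- Discrete chain rule: the increment of the energy is the pairing of the increments of `a`, `n`,
`v` with the discrete variational derivatives, plus the contribution of the moving reference. The
Hamiltonian structure cancels everything in the pairing except the residuals. -/
theorem IsPerturbedStep.energy_identity (h : IsPerturbedStep dt dx K m a w n v p rE rN rV)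
    (hdt : dt ≠ 0) :
    meshSum dx K (energyDensity dx (a (m + 1)) (w (m + 1)) (n (m + 1)) (v (m + 1)) (p (m + 1)))
      - meshSum dx K (energyDensity dx (a m) (w m) (n m) (v m) (p m))
      = dt * meshSum dx K (energyRate dt dx a w n v p rE rN rV m) := by
  have hper := mtPlus_periodic h.periodic_a h.periodic_a_succ
  have hr := meshSum_sq_dxPlus_sub (dx := dx) (K := K) (m := m) (u := fun m k => (a m k).re)
    (fun k => by simp only [h.periodic_a]) (fun k => by simp only [h.periodic_a_succ])
  have hi := meshSum_sq_dxPlus_sub (dx := dx) (K := K) (m := m) (u := fun m k => (a m k).im)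
    (fun k => by simp only [h.periodic_a]) (fun k => by simp only [h.periodic_a_succ])
  have hv := meshSum_sq_dxPlus_sub (dx := dx) (K := K) (m := m) (u := v)
    h.periodic_v h.periodic_v_succ
  have hrV := meshSum_mul_dxTwo (dx := dx) (K := K) h.periodic_rV
    (mtPlus_periodic h.periodic_v h.periodic_v_succ)
  have h1 := meshSum_mul_dxTwo (dx := dx) (K := K) (b := fun k => (rE k).re)
    (u := fun k => (mtPlus a m k).im) (fun k => by simp only [h.periodic_rE])
    (fun k => by simp only [hper])
  have h2 := meshSum_mul_dxTwo (dx := dx) (K := K) (b := fun k => (rE k).im)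
    (u := fun k => (mtPlus a m k).re) (fun k => by simp only [h.periodic_rE])
    (fun k => by simp only [hper])
  have mre : mtPlus (fun m k => (a m k).re) m = fun k => (mtPlus a m k).re := by
    funext k; simp [mtPlus]; ring
  have mim : mtPlus (fun m k => (a m k).im) m = fun k => (mtPlus a m k).im := by
    funext k; simp [mtPlus]; ring
  rw [mre] at hr
  rw [mim] at hi
  rw [← sub_eq_zero, ← meshSum_const_mul, ← meshSum_sub, ← meshSum_sub]
  rw [← sub_eq_zero, ← meshSum_sub] at hr hi hv
  rw [eq_neg_iff_add_eq_zero, ← meshSum_add] at hrV h1 h2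
  -- All summations by parts are collected in one vanishing sum, which reduces the identity to a
  -- pointwise algebraic one.
  have h0 : 0 = meshSum dx K (fun k =>
      (dxPlus dx (fun k => (a (m + 1) k).re) k ^ 2 - dxPlus dx (fun k => (a m k).re) k ^ 2
        - -2 * (((a (m + 1) k).re - (a m k).re) * dxTwo dx (fun k => (mtPlus a m k).re) k))
      + (dxPlus dx (fun k => (a (m + 1) k).im) k ^ 2 - dxPlus dx (fun k => (a m k).im) k ^ 2
        - -2 * (((a (m + 1) k).im - (a m k).im) * dxTwo dx (fun k => (mtPlus a m k).im) k))
      + 1 / 2 * (dxPlus dx (v (m + 1)) k ^ 2 - dxPlus dx (v m) k ^ 2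
        - -2 * ((v (m + 1) k - v m k) * dxTwo dx (mtPlus v m) k))
      + dt * (rV k * dxTwo dx (mtPlus v m) k + dxPlus dx rV k * dxPlus dx (mtPlus v m) k)
      - 2 * dt * ((rE k).re * dxTwo dx (fun k => (mtPlus a m k).im) k
        + dxPlus dx (fun k => (rE k).re) k * dxPlus dx (fun k => (mtPlus a m k).im) k)
      + 2 * dt * ((rE k).im * dxTwo dx (fun k => (mtPlus a m k).re) k
        + dxPlus dx (fun k => (rE k).im) k * dxPlus dx (fun k => (mtPlus a m k).re) k)) := by
    rw [meshSum_add, meshSum_sub, meshSum_add, meshSum_add, meshSum_add, hr, hi,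
      meshSum_const_mul, meshSum_const_mul, meshSum_const_mul, meshSum_const_mul, hv, hrV, h1, h2]
    ring
  rw [h0]
  congr 1
  funext k
  have e1 := h.eq_re hdt k
  have e2 := h.eq_im hdt k
  have e3 := h.eq_n k
  have e4 := h.eq_v k
  simp only [dtPlus, smul_eq_mul] at e3 e4
  rw [inv_mul_eq_iff_eq_mul₀ hdt] at e3 e4
  have hwr : dt * (dtPlus dt w m k).re = (w (m + 1) k).re - (w m k).re := by
    rw [dtPlus_re]; simp only [dtPlus, smul_eq_mul]; field_simp
  have hwi : dt * (dtPlus dt w m k).im = (w (m + 1) k).im - (w m k).im := by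
    rw [dtPlus_im]; simp only [dtPlus, smul_eq_mul]; field_simp
  have hp : dt * dtPlus dt p m k = p (m + 1) k - p m k := by
    simp only [dtPlus, smul_eq_mul]; field_simp
  simp only [← dxTwo_re, ← dxTwo_im, ← dxPlus_re, ← dxPlus_im, energyDensity, energyRate,
    sq_norm_complex, Complex.mul_im, Complex.conj_re, Complex.conj_im, Complex.add_im,
    Complex.add_re, Complex.mul_re, Complex.ofReal_re, Complex.ofReal_im]
    at e1 e2 e3 e4 ⊢
  have mn : mtPlus n m k = 2⁻¹ * (n (m + 1) k + n m k) := rfl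
  have mp : mtPlus p m k = 2⁻¹ * (p (m + 1) k + p m k) := rfl
  generalize dxTwo dx (mtPlus v m) k = X at *
  simp only [mn, mp, mtPlus_re, mtPlus_im] at e1 e2 e3 e4 ⊢
  simp only [mtPlus, smul_eq_mul] at e4 ⊢
  -- The multipliers of `e1` and `e2` are twice the imaginary and real parts of `-δ²μa + (μp + μn)μa
  -- + μn μw`, the variational derivative in `a`; those of `e3` and `e4` are the derivatives in `n`
  -- and `v`. The last three terms account for the change of `w` and `p`.
  linear_combination
    (-2 * (dxTwo dx (mtPlus a m) k).im + 2 * ((2⁻¹ * (p (m + 1) k + p m k)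
        + 2⁻¹ * (n (m + 1) k + n m k)) * (2⁻¹ * ((a (m + 1) k).im + (a m k).im))
      + 2⁻¹ * (n (m + 1) k + n m k) * (2⁻¹ * ((w (m + 1) k).im + (w m k).im)))) * e1
    + (-2 * (dxTwo dx (mtPlus a m) k).re + 2 * ((2⁻¹ * (p (m + 1) k + p m k)
        + 2⁻¹ * (n (m + 1) k + n m k)) * (2⁻¹ * ((a (m + 1) k).re + (a m k).re))
      + 2⁻¹ * (n (m + 1) k + n m k) * (2⁻¹ * ((w (m + 1) k).re + (w m k).re)))) * e2
    + (2⁻¹ * (n (m + 1) k + n m k) + 2⁻¹ * ((a (m + 1) k).re ^ 2 + (a (m + 1) k).im ^ 2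
        + 2 * ((w (m + 1) k).re * (a (m + 1) k).re + (w (m + 1) k).im * (a (m + 1) k).im)
        + ((a m k).re ^ 2 + (a m k).im ^ 2
          + 2 * ((w m k).re * (a m k).re + (w m k).im * (a m k).im)))) * e3
    - X * e4
    - 2 * (2⁻¹ * (n (m + 1) k + n m k)) * (2⁻¹ * ((a (m + 1) k).re + (a m k).re)) * hwr
    - 2 * (2⁻¹ * (n (m + 1) k + n m k)) * (2⁻¹ * ((a (m + 1) k).im + (a m k).im)) * hwi
    - 2⁻¹ * ((a (m + 1) k).re ^ 2 + (a (m + 1) k).im ^ 2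
        + ((a m k).re ^ 2 + (a m k).im ^ 2)) * hp

end

/-! ### A priori bound -/

section

variable {dt dx : ℝ} {K m : ℕ} {a w : ℕ → ℤ → ℂ} {n v p : ℕ → ℤ → ℝ}
  {rE : ℤ → ℂ} {rN rV : ℤ → ℝ}

/-- Mesh functions of bounded mass and energy are bounded. -/
theorem sq_norm_le_of_mass_energy {u : ℤ → ℂ} {ν ψ : ℤ → ℝ} {L μ₀ h₀ : ℝ} (hdx : 0 < dx)
    (hK : 0 < K) (hL : (K : ℝ) * dx = L) (hu : ∀ k, u (k + K) = u k)
    (hmass : meshSum dx K (fun k => ‖u k‖ ^ 2) ≤ μ₀)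
    (henergy : meshSum dx K (energyDensity dx u 0 ν ψ 0) ≤ h₀)
    {j : ℤ} (hj : j ∈ Finset.Icc (1 : ℤ) (K : ℤ)) :
    ‖u j‖ ^ 2 ≤ L⁻¹ * μ₀ + μ₀ + (2 * h₀ + L⁻¹ * μ₀ ^ 2 + μ₀ ^ 3) := by
  have hLpos : 0 < L := by rw [← hL]; positivity
  have hGN := fun j hj => sq_norm_le_of_periodic hdx hK hu (j := j) hj
  rw [hL] at hGN
  have hY0 : 0 ≤ meshSum dx K (fun k => ‖u k‖ ^ 2) := meshSum_nonneg hdx.le fun k => sq_nonneg _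
  have hX0 : 0 ≤ meshSum dx K (fun k => ‖dxPlus dx u k‖ ^ 2) :=
    meshSum_nonneg hdx.le fun k => sq_nonneg _
  set Y := meshSum dx K (fun k => ‖u k‖ ^ 2) with hY
  set X := meshSum dx K (fun k => ‖dxPlus dx u k‖ ^ 2) with hX
  -- Completing the square, `n|u|² + n²/2 ≥ -|u|⁴/2`; one factor `|u|²` is then replaced by its
  -- Gagliardo–Nirenberg bound.
  have hlow : X - 1 / 2 * (L⁻¹ * Y + 2 * (√Y * √X)) * Y ≤ h₀ := by
    refine le_trans ?_ henergy
    have e : X - 1 / 2 * (L⁻¹ * Y + 2 * (√Y * √X)) * Y = meshSum dx K (fun k =>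
        ‖dxPlus dx u k‖ ^ 2 - 1 / 2 * (L⁻¹ * Y + 2 * (√Y * √X)) * ‖u k‖ ^ 2) := by
      rw [meshSum_sub, meshSum_const_mul]
    rw [e]
    refine meshSum_mono hdx.le fun k hk => ?_
    have h1 := hGN k hk
    have h2 := mul_le_mul_of_nonneg_right h1 (sq_nonneg ‖u k‖)
    simp only [energyDensity, Pi.zero_apply, Complex.zero_re, Complex.zero_im]
    nlinarith [sq_nonneg (ν k + ‖u k‖ ^ 2), sq_nonneg (dxPlus dx ψ k)]
  have s1 := Real.sq_sqrt hY0
  have s2 := Real.sq_sqrt hX0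
  have hX' : X ≤ 2 * h₀ + L⁻¹ * Y ^ 2 + Y ^ 3 := by
    -- Young's inequality: the term is linear in `√X`, hence absorbed by half of `X`.
    have h3 : √Y * √X * Y ≤ (Y ^ 3 + X) / 2 := by
      have e : Y ^ 3 = (√Y * Y) ^ 2 := by rw [mul_pow, s1]; ring
      rw [e]
      nlinarith [sq_nonneg (√Y * Y - √X)]
    nlinarith
  have h4 := hGN j hj
  have h5 : 2 * (√Y * √X) ≤ Y + X := by nlinarith [sq_nonneg (√Y - √X)]
  have h6 : L⁻¹ * Y ≤ L⁻¹ * μ₀ := by gcongr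
  have h7 : L⁻¹ * Y ^ 2 ≤ L⁻¹ * μ₀ ^ 2 := by gcongr
  have h8 : Y ^ 3 ≤ μ₀ ^ 3 := by gcongr
  linarith

/-- A solution of the scheme is bounded in terms of its initial mass and energy. -/
theorem sq_norm_le_of_steps {M : ℕ} {L μ₀ h₀ : ℝ} (hdx : 0 < dx) (hdt : 0 < dt)
    (hK : 0 < K) (hL : (K : ℝ) * dx = L) (hper : ∀ m ≤ M, ∀ k, a m (k + K) = a m k)
    (hstep : ∀ m < M, IsPerturbedStep dt dx K m a 0 n v 0 0 0 0)
    (hmass : meshSum dx K (fun k => ‖a 0 k‖ ^ 2) ≤ μ₀)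
    (henergy : meshSum dx K (energyDensity dx (a 0) 0 (n 0) (v 0) 0) ≤ h₀) :
    ∀ m ≤ M, ∀ j ∈ Finset.Icc (1 : ℤ) (K : ℤ),
      ‖a m j‖ ^ 2 ≤ L⁻¹ * μ₀ + μ₀ + (2 * h₀ + L⁻¹ * μ₀ ^ 2 + μ₀ ^ 3) := by
  have key : ∀ m ≤ M, meshSum dx K (fun k => ‖a m k‖ ^ 2) ≤ μ₀
      ∧ meshSum dx K (energyDensity dx (a m) 0 (n m) (v m) 0) ≤ h₀ := by
    intro m
    induction m with
    | zero => exact fun _ => ⟨hmass, henergy⟩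
    | succ m ih =>
      intro hm
      obtain ⟨i1, i2⟩ := ih (by omega)
      have hs := hstep m (by omega)
      have e1 := hs.mass_identity hdt.ne'
      have e2 := hs.energy_identity hdt.ne'
      -- With zero reference and residuals both rates vanish: these are the conservation laws of the
      -- scheme.
      have z1 : meshSum dx K (fun k => 2 * ((((mtPlus n m k : ℝ) : ℂ)
          * mtPlus (0 : ℕ → ℤ → ℂ) m k - (0 : ℤ → ℂ) k) * (starRingEnd ℂ) (mtPlus a m k)).im)
          = 0 := by
        simp [meshSum, mtPlus]
      have z2 : meshSum dx K (energyRate dt dx a 0 n v 0 0 0 0 m) = 0 := by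
        simp [meshSum, energyRate, dtPlus, dxPlus]
      rw [z1, mul_zero, sub_eq_zero] at e1
      rw [z2, mul_zero, sub_eq_zero] at e2
      exact ⟨e1.le.trans i1, e2.le.trans i2⟩
  intro m hm j hj
  exact sq_norm_le_of_mass_energy hdx hK hL (hper m hm) (key m hm).1 (key m hm).2 hj

/-! ### Growth of the relative energy -/

/-- The density of the error functional. -/
def errorDensity (dx : ℝ) (a : ℤ → ℂ) (n v : ℤ → ℝ) (k : ℤ) : ℝ :=
  ‖a k‖ ^ 2 + ‖dxPlus dx a k‖ ^ 2 + n k ^ 2 + dxPlus dx v k ^ 2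

theorem errorFunctional_eq (hdx : 0 ≤ dx) (a : ℤ → ℂ) (n v : ℤ → ℝ) :
    errorFunctional dx K a n v = meshSum dx K (errorDensity dx a n v) := by
  unfold errorFunctional errorDensity
  simp only [meshNorm_sq hdx, meshSum_add, Real.norm_eq_abs, sq_abs]

theorem sq_norm_mtPlus_le {F : Type*} [NormedAddCommGroup F] [NormedSpace ℝ F] (u : ℕ → ℤ → F)
    (m : ℕ) (k : ℤ) : ‖mtPlus u m k‖ ^ 2 ≤ (‖u (m + 1) k‖ ^ 2 + ‖u m k‖ ^ 2) / 2 := by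
  have h : ‖mtPlus u m k‖ ≤ (‖u (m + 1) k‖ + ‖u m k‖) / 2 := by
    rw [mtPlus, norm_smul, norm_inv, Real.norm_two]
    linarith [norm_add_le (u (m + 1) k) (u m k)]
  have := pow_le_pow_left₀ (norm_nonneg _) h 2
  nlinarith [sq_nonneg (‖u (m + 1) k‖ - ‖u m k‖)]

theorem norm_mtPlus_le {F : Type*} [NormedAddCommGroup F] [NormedSpace ℝ F] {u : ℕ → ℤ → F}
    {B : ℝ} {m : ℕ} {k : ℤ} (h0 : ‖u m k‖ ≤ B) (h1 : ‖u (m + 1) k‖ ≤ B) : ‖mtPlus u m k‖ ≤ B := by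
  rw [mtPlus, norm_smul, norm_inv, Real.norm_two]
  linarith [norm_add_le (u (m + 1) k) (u m k)]

theorem dxPlus_mtPlus {F : Type*} [NormedAddCommGroup F] [NormedSpace ℝ F] (dx : ℝ)
    (u : ℕ → ℤ → F) (m : ℕ) (k : ℤ) :
    dxPlus dx (mtPlus u m) k = mtPlus (fun m => dxPlus dx (u m)) m k := by
  simp only [dxPlus, mtPlus]; module

theorem abs_re_mul_add_im_mul_le (z y : ℂ) : |z.re * y.re + z.im * y.im| ≤ ‖z‖ * ‖y‖ := by
  have h := Complex.abs_re_le_norm (z * (starRingEnd ℂ) y)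
  rw [norm_mul, Complex.norm_conj, Complex.mul_re, Complex.conj_re, Complex.conj_im] at h
  rwa [mul_neg, sub_neg_eq_add] at h

theorem abs_im_mul_sub_re_mul_le (z y : ℂ) : |z.im * y.re - z.re * y.im| ≤ ‖z‖ * ‖y‖ := by
  have h := Complex.abs_im_le_norm (z * (starRingEnd ℂ) y)
  rw [norm_mul, Complex.norm_conj, Complex.mul_im, Complex.conj_re, Complex.conj_im] at h
  rwa [show z.im * y.re - z.re * y.im = z.re * -y.im + z.im * y.re by ring]

/-- Pointwise bounds on the deviation, the reference and the residuals at time step `m` and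
mesh point `k`. -/
structure StepBounds (dt dx B R : ℝ) (a w : ℕ → ℤ → ℂ) (n p : ℕ → ℤ → ℝ)
    (rE : ℤ → ℂ) (rN rV : ℤ → ℝ) (m : ℕ) (k : ℤ) : Prop where
  a_le : ‖a m k‖ ≤ B
  a_succ_le : ‖a (m + 1) k‖ ≤ B
  w_le : ‖w m k‖ ≤ B
  w_succ_le : ‖w (m + 1) k‖ ≤ B
  p_le : ‖p m k‖ ≤ B
  p_succ_le : ‖p (m + 1) k‖ ≤ B
  dt_w_le : ‖dtPlus dt w m k‖ ≤ B
  dt_p_le : ‖dtPlus dt p m k‖ ≤ B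
  rE_le : ‖rE k‖ ≤ R
  rN_le : ‖rN k‖ ≤ R
  dx_rE_le : ‖dxPlus dx rE k‖ ≤ R
  dx_rV_le : ‖dxPlus dx rV k‖ ≤ R

theorem StepBounds.massRate_le {B R : ℝ} {k : ℤ} (hB : 1 ≤ B)
    (h : StepBounds dt dx B R a w n p rE rN rV m k) :
    2 * ((((mtPlus n m k : ℝ) : ℂ) * mtPlus w m k - rE k) * (starRingEnd ℂ) (mtPlus a m k)).im
      ≤ 2 * B ^ 2 * (errorDensity dx (a (m + 1)) (n (m + 1)) (v (m + 1)) k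
        + errorDensity dx (a m) (n m) (v m) k + R ^ 2) := by
  have h1 := (le_abs_self _).trans (Complex.abs_im_le_norm
    ((((mtPlus n m k : ℝ) : ℂ) * mtPlus w m k - rE k) * (starRingEnd ℂ) (mtPlus a m k)))
  rw [norm_mul, Complex.norm_conj] at h1
  have hw := norm_mtPlus_le h.w_le h.w_succ_le
  have h2 : ‖((mtPlus n m k : ℝ) : ℂ) * mtPlus w m k - rE k‖ ≤ ‖mtPlus n m k‖ * B + R := by
    refine (norm_sub_le _ _).trans ?_
    rw [norm_mul, Complex.norm_real]
    have := h.rE_le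
    gcongr
  have hn := sq_norm_mtPlus_le n m k
  have ha := sq_norm_mtPlus_le a m k
  have h3 := h1.trans (mul_le_mul_of_nonneg_right h2 (norm_nonneg _))
  simp only [Real.norm_eq_abs, sq_abs] at hn
  have e1 : 2 * (|mtPlus n m k| * ‖mtPlus a m k‖) ≤ mtPlus n m k ^ 2 + ‖mtPlus a m k‖ ^ 2 := by
    nlinarith [sq_nonneg (|mtPlus n m k| - ‖mtPlus a m k‖), sq_abs (mtPlus n m k)]
  have e2 : 2 * (R * ‖mtPlus a m k‖) ≤ R ^ 2 + ‖mtPlus a m k‖ ^ 2 := by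
    nlinarith [sq_nonneg (R - ‖mtPlus a m k‖)]
  have hBB : B ≤ B ^ 2 := by nlinarith
  have e3 : B * (2 * (|mtPlus n m k| * ‖mtPlus a m k‖))
      ≤ B ^ 2 * (mtPlus n m k ^ 2 + ‖mtPlus a m k‖ ^ 2) := by
    refine (mul_le_mul_of_nonneg_left e1 (by linarith)).trans ?_
    gcongr
  have e4 : 2 * (R * ‖mtPlus a m k‖) ≤ B ^ 2 * (R ^ 2 + ‖mtPlus a m k‖ ^ 2) := by
    refine e2.trans (le_mul_of_one_le_left (by positivity) (by nlinarith))
  have e5 : B ^ 2 * (mtPlus n m k ^ 2 + ‖mtPlus a m k‖ ^ 2) + B ^ 2 * (R ^ 2 + ‖mtPlus a m k‖ ^ 2)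
      ≤ 2 * B ^ 2 * (errorDensity dx (a (m + 1)) (n (m + 1)) (v (m + 1)) k
        + errorDensity dx (a m) (n m) (v m) k + R ^ 2) := by
    rw [← mul_add, mul_comm 2, mul_assoc]
    refine mul_le_mul_of_nonneg_left ?_ (by positivity)
    unfold errorDensity
    have := sq_nonneg ‖dxPlus dx (a (m + 1)) k‖
    have := sq_nonneg ‖dxPlus dx (a m) k‖
    have := sq_nonneg (dxPlus dx (v (m + 1)) k)
    have := sq_nonneg (dxPlus dx (v m) k)
    have := sq_nonneg ‖a m k‖
    have := sq_nonneg ‖a (m + 1) k‖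
    have := sq_nonneg (n m k)
    have := sq_nonneg (n (m + 1) k)
    have := sq_nonneg R
    linarith
  rw [Real.norm_eq_abs] at h3
  linarith

/-- The sup bound on `a` makes every term at most quadratic in the error and the residuals, and
Young's inequality separates the two. The estimates `t1` to `t6` treat the summands of `energyRate`
in order. -/
theorem StepBounds.energyRate_le {B R : ℝ} {k : ℤ} (hB : 1 ≤ B)
    (h : StepBounds dt dx B R a w n p rE rN rV m k) :
    energyRate dt dx a w n v p rE rN rV m k
      ≤ 6 * B ^ 2 * (errorDensity dx (a (m + 1)) (n (m + 1)) (v (m + 1)) k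
        + errorDensity dx (a m) (n m) (v m) k + R ^ 2) := by
  have hB0 : 0 ≤ B := by linarith
  have hBB : B ≤ B ^ 2 := le_self_pow₀ hB two_ne_zero
  have hB2 : 0 ≤ B ^ 2 - 1 := sub_nonneg.2 (one_le_pow₀ hB)
  have hR : 0 ≤ R := (norm_nonneg _).trans h.rE_le
  have hn := sq_norm_mtPlus_le n m k
  have ha := sq_norm_mtPlus_le a m k
  have hda := sq_norm_mtPlus_le (fun m => dxPlus dx (a m)) m k
  have hdv := sq_norm_mtPlus_le (fun m => dxPlus dx (v m)) m k
  rw [← dxPlus_mtPlus] at hda hdv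
  have hw := norm_mtPlus_le h.w_le h.w_succ_le
  have ham := norm_mtPlus_le h.a_le h.a_succ_le
  have hp := norm_mtPlus_le h.p_le h.p_succ_le
  have two : ∀ {s t S : ℝ}, |s| ≤ S * t → 0 ≤ t → S ≤ R → 2 * |s| ≤ R ^ 2 + t ^ 2 := by
    intro s t S h1 h2 h3
    linarith [sq_nonneg (R - t), mul_le_mul_of_nonneg_right h3 h2]
  have t1 : -2 * ((dxPlus dx rE k).im * (dxPlus dx (mtPlus a m) k).re
      - (dxPlus dx rE k).re * (dxPlus dx (mtPlus a m) k).im)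
      ≤ R ^ 2 + ‖dxPlus dx (mtPlus a m) k‖ ^ 2 := by
    have := two (abs_im_mul_sub_re_mul_le _ _) (norm_nonneg (dxPlus dx (mtPlus a m) k)) h.dx_rE_le
    linarith [neg_abs_le ((dxPlus dx rE k).im * (dxPlus dx (mtPlus a m) k).re
      - (dxPlus dx rE k).re * (dxPlus dx (mtPlus a m) k).im)]
  have t2 : -(2 * (rE k * (starRingEnd ℂ) (((mtPlus p m k + mtPlus n m k : ℝ) : ℂ) * mtPlus a m k
      + ((mtPlus n m k : ℝ) : ℂ) * mtPlus w m k)).im)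
      ≤ R ^ 2 + (2 * B ^ 2 * ‖mtPlus a m k‖ ^ 2 + 8 * B ^ 2 * ‖mtPlus n m k‖ ^ 2) := by
    set F := ((mtPlus p m k + mtPlus n m k : ℝ) : ℂ) * mtPlus a m k
      + ((mtPlus n m k : ℝ) : ℂ) * mtPlus w m k with hF
    have hFle : ‖F‖ ≤ B * ‖mtPlus a m k‖ + 2 * B * ‖mtPlus n m k‖ := by
      have e : F = ((mtPlus p m k : ℝ) : ℂ) * mtPlus a m k
          + ((mtPlus n m k : ℝ) : ℂ) * mtPlus a m k + ((mtPlus n m k : ℝ) : ℂ) * mtPlus w m k := by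
        rw [hF]; push_cast; ring
      rw [e]
      refine (norm_add₃_le).trans ?_
      simp only [norm_mul, Complex.norm_real]
      have e1 := mul_le_mul_of_nonneg_right hp (norm_nonneg (mtPlus a m k))
      have e2 := mul_le_mul_of_nonneg_left ham (norm_nonneg (mtPlus n m k))
      have e3 := mul_le_mul_of_nonneg_left hw (norm_nonneg (mtPlus n m k))
      linarith
    have hF2 : ‖F‖ ^ 2 ≤ 2 * B ^ 2 * ‖mtPlus a m k‖ ^ 2 + 8 * B ^ 2 * ‖mtPlus n m k‖ ^ 2 := by
      refine (pow_le_pow_left₀ (norm_nonneg _) hFle 2).trans ?_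
      linarith [sq_nonneg (B * ‖mtPlus a m k‖ - 2 * B * ‖mtPlus n m k‖)]
    have h1 := Complex.abs_im_le_norm (rE k * (starRingEnd ℂ) F)
    rw [norm_mul, Complex.norm_conj] at h1
    have := two h1 (norm_nonneg _) h.rE_le
    linarith [neg_abs_le (rE k * (starRingEnd ℂ) F).im]
  have t3 : -(dxPlus dx rV k * dxPlus dx (mtPlus v m) k)
      ≤ (R ^ 2 + ‖dxPlus dx (mtPlus v m) k‖ ^ 2) / 2 := by
    have h1 : |dxPlus dx rV k * dxPlus dx (mtPlus v m) k|
      ≤ ‖dxPlus dx rV k‖ * ‖dxPlus dx (mtPlus v m) k‖ := (abs_mul _ _).le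
    have := two h1 (norm_nonneg _) h.dx_rV_le
    linarith [neg_abs_le (dxPlus dx rV k * dxPlus dx (mtPlus v m) k)]
  have t4 : -(rN k * (mtPlus n m k + mtPlus (fun j l => ‖a j l‖ ^ 2
      + 2 * ((w j l).re * (a j l).re + (w j l).im * (a j l).im)) m k))
      ≤ R ^ 2 + ‖mtPlus n m k‖ ^ 2 / 2
        + 9 / 4 * B ^ 2 * (‖a (m + 1) k‖ ^ 2 + ‖a m k‖ ^ 2) := by
    set q := mtPlus (fun j l => ‖a j l‖ ^ 2
      + 2 * ((w j l).re * (a j l).re + (w j l).im * (a j l).im)) m k with hq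
    have hq2 : ‖q‖ ^ 2 ≤ 9 / 2 * B ^ 2 * (‖a (m + 1) k‖ ^ 2 + ‖a m k‖ ^ 2) := by
      have hj : ∀ j, ‖a j k‖ ≤ B → ‖w j k‖ ≤ B → ‖‖a j k‖ ^ 2
          + 2 * ((w j k).re * (a j k).re + (w j k).im * (a j k).im)‖ ^ 2
          ≤ 9 * B ^ 2 * ‖a j k‖ ^ 2 := by
        intro j h1 h2
        have h3 : ‖‖a j k‖ ^ 2 + 2 * ((w j k).re * (a j k).re + (w j k).im * (a j k).im)‖
            ≤ 3 * B * ‖a j k‖ := by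
          have h4 := abs_re_mul_add_im_mul_le (w j k) (a j k)
          have h5 := mul_le_mul_of_nonneg_right h2 (norm_nonneg (a j k))
          have h6 := mul_le_mul_of_nonneg_right h1 (norm_nonneg (a j k))
          rw [Real.norm_eq_abs]
          refine (abs_add_le _ _).trans ?_
          rw [abs_mul, abs_two, abs_of_nonneg (sq_nonneg ‖a j k‖)]
          linarith
        refine (pow_le_pow_left₀ (norm_nonneg _) h3 2).trans (le_of_eq (by ring))
      have h1 := sq_norm_mtPlus_le (fun j l => ‖a j l‖ ^ 2
        + 2 * ((w j l).re * (a j l).re + (w j l).im * (a j l).im)) m k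
      linarith [hj m h.a_le h.w_le, hj (m + 1) h.a_succ_le h.w_succ_le]
    have h1 : |rN k * mtPlus n m k| ≤ ‖rN k‖ * ‖mtPlus n m k‖ := (abs_mul _ _).le
    have h2 : |rN k * q| ≤ ‖rN k‖ * ‖q‖ := (abs_mul _ _).le
    have h3 := two h1 (norm_nonneg _) h.rN_le
    have h4 := two h2 (norm_nonneg _) h.rN_le
    rw [mul_add]
    linarith [neg_abs_le (rN k * mtPlus n m k), neg_abs_le (rN k * q)]
  have t5 : 2 * mtPlus n m k * ((dtPlus dt w m k).re * (mtPlus a m k).re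
      + (dtPlus dt w m k).im * (mtPlus a m k).im) ≤ B * (‖mtPlus n m k‖ ^ 2 + ‖mtPlus a m k‖ ^ 2) := by
    have h1 := abs_re_mul_add_im_mul_le (dtPlus dt w m k) (mtPlus a m k)
    have h2 := h1.trans (mul_le_mul_of_nonneg_right h.dt_w_le (norm_nonneg _))
    have h3 := mul_le_mul_of_nonneg_left h2 (abs_nonneg (mtPlus n m k))
    rw [← abs_mul] at h3
    have h4 := (le_abs_self _).trans h3
    rw [Real.norm_eq_abs]
    linarith [mul_nonneg hB0 (sq_nonneg (|mtPlus n m k| - ‖mtPlus a m k‖))]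
  have t6 : dtPlus dt p m k * mtPlus (fun j l => ‖a j l‖ ^ 2) m k
      ≤ B * ((‖a (m + 1) k‖ ^ 2 + ‖a m k‖ ^ 2) / 2) := by
    have h1 : mtPlus (fun j l => ‖a j l‖ ^ 2) m k = (‖a (m + 1) k‖ ^ 2 + ‖a m k‖ ^ 2) / 2 := by
      simp only [mtPlus, smul_eq_mul]; ring
    rw [h1]
    exact mul_le_mul_of_nonneg_right ((le_abs_self _).trans h.dt_p_le) (by positivity)
  have u5 : B * (‖mtPlus n m k‖ ^ 2 + ‖mtPlus a m k‖ ^ 2)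
      ≤ B ^ 2 * (‖mtPlus n m k‖ ^ 2 + ‖mtPlus a m k‖ ^ 2) := by gcongr
  have u6 : B * ((‖a (m + 1) k‖ ^ 2 + ‖a m k‖ ^ 2) / 2)
      ≤ B ^ 2 * ((‖a (m + 1) k‖ ^ 2 + ‖a m k‖ ^ 2) / 2) := by gcongr
  have hn' := mul_le_mul_of_nonneg_left hn (sq_nonneg B)
  have ha' := mul_le_mul_of_nonneg_left ha (sq_nonneg B)
  unfold energyRate errorDensity
  simp only [Real.norm_eq_abs, sq_abs] at hn hdv hn' t2 t3 t4 t5 u5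
  clear two ham hp hw h
  -- Since `B ≥ 1`, all coefficients can be compared with multiples of `B ^ 2`. The largest that
  -- arises is `19/4`, on the two squares of `n`, so `6` suffices.
  have q1 := mul_nonneg hB2 (sq_nonneg R)
  have q2 := mul_nonneg hB2 (sq_nonneg (n m k))
  have q3 := mul_nonneg hB2 (sq_nonneg (n (m + 1) k))
  have q4 := mul_nonneg hB2 (sq_nonneg ‖dxPlus dx (a (m + 1)) k‖)
  have q5 := mul_nonneg hB2 (sq_nonneg ‖dxPlus dx (a m) k‖)
  have q6 := mul_nonneg hB2 (sq_nonneg (dxPlus dx (v (m + 1)) k))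
  have q7 := mul_nonneg hB2 (sq_nonneg (dxPlus dx (v m) k))
  have q8 := mul_nonneg (sq_nonneg B) (sq_nonneg ‖a m k‖)
  have q9 := mul_nonneg (sq_nonneg B) (sq_nonneg ‖a (m + 1) k‖)
  have r1 := sq_nonneg R
  have r2 := sq_nonneg (n m k)
  have r3 := sq_nonneg (n (m + 1) k)
  have r4 := sq_nonneg ‖dxPlus dx (a (m + 1)) k‖
  have r5 := sq_nonneg ‖dxPlus dx (a m) k‖
  have r6 := sq_nonneg (dxPlus dx (v (m + 1)) k)
  have r7 := sq_nonneg (dxPlus dx (v m) k)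
  linarith

/-- The relative energy with a multiple of the mass added. -/
def lyapunov (dx : ℝ) (K : ℕ) (B : ℝ) (a w : ℤ → ℂ) (n v p : ℤ → ℝ) : ℝ :=
  meshSum dx K (energyDensity dx a w n v p) + 12 * B ^ 2 * meshSum dx K (fun k => ‖a k‖ ^ 2)

/-- By Young's inequality the three indefinite terms cost `B²`, `2B²` and `8B²` times `‖u‖²`, and
the two containing `ν` use `ν²/8` each. The weight `12B²` leaves at least `‖u‖²`, and `ν²/4`
remains, whence the factor `4`. -/
theorem errorDensity_le_lyapunov {B : ℝ} (hdx : 0 ≤ dx) (hB : 1 ≤ B) {u ω : ℤ → ℂ} {ν ψ π : ℤ → ℝ}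
    (hu : ∀ k ∈ Finset.Icc (1 : ℤ) (K : ℤ), ‖u k‖ ≤ B)
    (hω : ∀ k ∈ Finset.Icc (1 : ℤ) (K : ℤ), ‖ω k‖ ≤ B)
    (hπ : ∀ k ∈ Finset.Icc (1 : ℤ) (K : ℤ), ‖π k‖ ≤ B) :
    meshSum dx K (errorDensity dx u ν ψ) ≤ 4 * lyapunov dx K B u ω ν ψ π := by
  unfold lyapunov
  rw [← meshSum_const_mul, ← meshSum_add, ← meshSum_const_mul]
  refine meshSum_mono hdx fun k hk => ?_
  have h1 := hu k hk
  have h2 := hω k hk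
  have h3 := hπ k hk
  have hx := norm_nonneg (u k)
  have e1 : -(π k * ‖u k‖ ^ 2) ≤ B ^ 2 * ‖u k‖ ^ 2 := by
    have : -π k ≤ B ^ 2 := (neg_le_abs _).trans (h3.trans (by nlinarith))
    nlinarith [mul_le_mul_of_nonneg_right this (sq_nonneg ‖u k‖)]
  have e2 : -(ν k * ‖u k‖ ^ 2) ≤ ν k ^ 2 / 8 + 2 * B ^ 2 * ‖u k‖ ^ 2 := by
    have h4 : ‖u k‖ ^ 2 * ‖u k‖ ^ 2 ≤ B ^ 2 * ‖u k‖ ^ 2 :=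
      mul_le_mul_of_nonneg_right (pow_le_pow_left₀ hx h1 2) (sq_nonneg _)
    nlinarith [sq_nonneg (ν k / 2 + 2 * ‖u k‖ ^ 2)]
  have e3 : -(2 * ν k * ((ω k).re * (u k).re + (ω k).im * (u k).im))
      ≤ ν k ^ 2 / 8 + 8 * B ^ 2 * ‖u k‖ ^ 2 := by
    have h4 := (abs_re_mul_add_im_mul_le (ω k) (u k)).trans
      (mul_le_mul_of_nonneg_right h2 (norm_nonneg _))
    have h5 := pow_le_pow_left₀ (abs_nonneg _) h4 2
    rw [sq_abs, mul_pow] at h5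
    nlinarith [sq_nonneg (ν k / 2 + 4 * ((ω k).re * (u k).re + (ω k).im * (u k).im))]
  unfold errorDensity energyDensity
  have q1 := sq_nonneg (dxPlus dx ψ k)
  have q2 := sq_nonneg ‖dxPlus dx u k‖
  have q3 : ‖u k‖ ^ 2 ≤ B ^ 2 * ‖u k‖ ^ 2 :=
    le_mul_of_one_le_left (sq_nonneg _) (by nlinarith)
  have q4 := sq_nonneg ‖u k‖
  linarith

theorem IsPerturbedStep.lyapunov_sub_le {B R : ℝ} (hdx : 0 ≤ dx) (hdt : 0 < dt) (hB : 1 ≤ B)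
    (h : IsPerturbedStep dt dx K m a w n v p rE rN rV)
    (hb : ∀ k ∈ Finset.Icc (1 : ℤ) (K : ℤ), StepBounds dt dx B R a w n p rE rN rV m k) :
    lyapunov dx K B (a (m + 1)) (w (m + 1)) (n (m + 1)) (v (m + 1)) (p (m + 1))
        - lyapunov dx K B (a m) (w m) (n m) (v m) (p m)
      ≤ dt * (120 * B ^ 4) * (lyapunov dx K B (a (m + 1)) (w (m + 1)) (n (m + 1)) (v (m + 1))
        (p (m + 1)) + lyapunov dx K B (a m) (w m) (n m) (v m) (p m) + K * dx * R ^ 2) := by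
  have l0 := errorDensity_le_lyapunov (ν := n m) (ψ := v m) hdx hB (fun k hk => (hb k hk).a_le)
    (fun k hk => (hb k hk).w_le) (fun k hk => (hb k hk).p_le)
  have l1 := errorDensity_le_lyapunov (ν := n (m + 1)) (ψ := v (m + 1)) hdx hB
    (fun k hk => (hb k hk).a_succ_le)
    (fun k hk => (hb k hk).w_succ_le) (fun k hk => (hb k hk).p_succ_le)
  have e1 := h.mass_identity hdt.ne'
  have e2 := h.energy_identity hdt.ne'
  have r1 := meshSum_mono hdx fun k hk => (hb k hk).massRate_le (v := v) hB
  have r2 := meshSum_mono hdx fun k hk => (hb k hk).energyRate_le (v := v) hB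
  rw [meshSum_const_mul (2 * B ^ 2), meshSum_add, meshSum_add, meshSum_const] at r1
  rw [meshSum_const_mul (6 * B ^ 2), meshSum_add, meshSum_add, meshSum_const] at r2
  have hKR : 0 ≤ K * dx * R ^ 2 := by positivity
  set P1 := lyapunov dx K B (a (m + 1)) (w (m + 1)) (n (m + 1)) (v (m + 1)) (p (m + 1)) with hP1
  set P0 := lyapunov dx K B (a m) (w m) (n m) (v m) (p m) with hP0
  set S := meshSum dx K (errorDensity dx (a (m + 1)) (n (m + 1)) (v (m + 1)))
    + meshSum dx K (errorDensity dx (a m) (n m) (v m)) + K * dx * R ^ 2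
  have hS0 : 0 ≤ S := by
    have hpos : ∀ (u : ℤ → ℂ) (ν ψ : ℤ → ℝ), 0 ≤ meshSum dx K (errorDensity dx u ν ψ) :=
      fun u ν ψ => meshSum_nonneg hdx fun k => by unfold errorDensity; positivity
    have := hpos (a m) (n m) (v m)
    have := hpos (a (m + 1)) (n (m + 1)) (v (m + 1))
    positivity
  have hS : S ≤ 4 * (P1 + P0 + K * dx * R ^ 2) := by linarith
  have hid : P1 - P0 = dt * (meshSum dx K (energyRate dt dx a w n v p rE rN rV m)
      + 12 * B ^ 2 * meshSum dx K (fun k => 2 * ((((mtPlus n m k : ℝ) : ℂ) * mtPlus w m k - rE k)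
        * (starRingEnd ℂ) (mtPlus a m k)).im)) := by
    rw [hP1, hP0, lyapunov, lyapunov]
    linear_combination e2 + 12 * B ^ 2 * e1
  rw [hid, mul_assoc dt (120 * B ^ 4)]
  refine mul_le_mul_of_nonneg_left ?_ hdt.le
  have r3 := mul_le_mul_of_nonneg_left r1 (show 0 ≤ 12 * B ^ 2 by positivity)
  have hB4 : B ^ 2 ≤ B ^ 4 := pow_le_pow_right₀ hB (by norm_num)
  -- The two rates add up to at most `30 B⁴ S`; the coercivity factor `4` in `hS` turns this into
  -- `120 B⁴`.
  have r4 : 6 * B ^ 2 * S + 12 * B ^ 2 * (2 * B ^ 2 * S) ≤ 30 * B ^ 4 * S := by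
    have := mul_le_mul_of_nonneg_right hB4 hS0
    nlinarith
  have r5 := mul_le_mul_of_nonneg_left hS (show 0 ≤ 30 * B ^ 4 by positivity)
  linarith

end

/-- Discrete Gronwall inequality for an implicit step. -/
theorem discrete_gronwall {Φ : ℕ → ℝ} {M : ℕ} {θ ρ : ℝ} (hθ : 0 ≤ θ) (hθ' : θ ≤ 1 / 2)
    (hρ : 0 ≤ ρ) (hΦ : ∀ m ≤ M, 0 ≤ Φ m)
    (hstep : ∀ m < M, Φ (m + 1) - Φ m ≤ θ * (Φ (m + 1) + Φ m + ρ)) :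
    ∀ m ≤ M, Φ m ≤ Real.exp (4 * θ * m) * (Φ 0 + ρ) := by
  have key : ∀ m ≤ M, Φ m + ρ ≤ Real.exp (4 * θ * m) * (Φ 0 + ρ) := by
    intro m
    induction m with
    | zero => simp
    | succ m ih =>
      intro hm
      have h1 := ih (by omega)
      have h2 := hstep m (by omega)
      have h3 := hΦ m (by omega)
      have h4 : Φ (m + 1) + ρ ≤ (1 + 4 * θ) * (Φ m + ρ) := by
        -- The step gives the bound `(1 + θ)(Φ m + ρ)`, and `1 + θ ≤ (1 - θ)(1 + 4θ)` holds because
        -- `θ ≤ 1/2`.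
        have h5 : (1 - θ) * (Φ (m + 1) + ρ) ≤ (1 - θ) * ((1 + 4 * θ) * (Φ m + ρ)) := by
          nlinarith [mul_nonneg (mul_nonneg hθ (show 0 ≤ 1 - 2 * θ by linarith))
            (add_nonneg h3 hρ), mul_nonneg hθ hρ]
        exact le_of_mul_le_mul_left h5 (by linarith)
      have h6 : 1 + 4 * θ ≤ Real.exp (4 * θ) := by linarith [Real.add_one_le_exp (4 * θ)]
      have h7 : Real.exp (4 * θ * (m + 1 : ℕ)) = Real.exp (4 * θ) * Real.exp (4 * θ * m) := by
        rw [← Real.exp_add]; push_cast; ring_nf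
      rw [h7, mul_assoc]
      exact h4.trans (mul_le_mul h6 h1 (by linarith) (Real.exp_pos _).le)
  intro m hm
  linarith [key m hm]

/-! ### Partial derivatives on the strip -/

section

variable {F : Type*} [NormedAddCommGroup F] [NormedSpace ℝ F] {T : ℝ} {n : ℕ} {f : ℝ → ℝ → F}

/-- The partial derivative in `t` on `[0, T] × ℝ`, one-sided at the end points. -/
def dT (T : ℝ) (f : ℝ → ℝ → F) (t x : ℝ) : F :=
  derivWithin (fun s => f s x) (Set.Icc 0 T) t

/-- The partial derivative in `x`. -/
def dX (f : ℝ → ℝ → F) (t x : ℝ) : F :=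
  deriv (f t) x

theorem SmoothOnStrip.of_le {m : ℕ} (h : SmoothOnStrip n T f) (hmn : m ≤ n) :
    SmoothOnStrip m T f :=
  ContDiffOn.of_le h (by exact_mod_cast hmn)

theorem SmoothOnStrip.hasFDerivWithinAt (h : SmoothOnStrip (n + 1) T f) {t : ℝ}
    (ht : t ∈ Set.Icc 0 T) (x : ℝ) :
    HasFDerivWithinAt (fun p : ℝ × ℝ => f p.1 p.2)
      (fderivWithin ℝ (fun p : ℝ × ℝ => f p.1 p.2) (Set.Icc 0 T ×ˢ Set.univ) (t, x))
      (Set.Icc 0 T ×ˢ Set.univ) (t, x) :=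
  ((ContDiffOn.differentiableOn h (by simp)) (t, x)
    ⟨ht, Set.mem_univ x⟩).hasFDerivWithinAt

theorem SmoothOnStrip.hasDerivWithinAt_fderivWithin (h : SmoothOnStrip (n + 1) T f) {t : ℝ}
    (ht : t ∈ Set.Icc 0 T) (x : ℝ) :
    HasDerivWithinAt (fun s => f s x)
      (fderivWithin ℝ (fun p : ℝ × ℝ => f p.1 p.2) (Set.Icc 0 T ×ˢ Set.univ) (t, x) (1, 0))
      (Set.Icc 0 T) t :=
  (h.hasFDerivWithinAt ht x).comp_hasDerivWithinAt (f := fun s => (s, x)) t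
    ((hasDerivWithinAt_id t _).prodMk (hasDerivWithinAt_const t _ x))
    fun _ hs => ⟨hs, Set.mem_univ x⟩

theorem SmoothOnStrip.hasDerivAt_fderivWithin (h : SmoothOnStrip (n + 1) T f) {t : ℝ}
    (ht : t ∈ Set.Icc 0 T) (x : ℝ) :
    HasDerivAt (f t)
      (fderivWithin ℝ (fun p : ℝ × ℝ => f p.1 p.2) (Set.Icc 0 T ×ˢ Set.univ) (t, x) (0, 1)) x := by
  rw [← hasDerivWithinAt_univ]
  exact (h.hasFDerivWithinAt ht x).comp_hasDerivWithinAt (f := fun y => (t, y)) x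
    ((hasDerivWithinAt_const x _ t).prodMk (hasDerivWithinAt_id x _))
    fun y hy => ⟨ht, hy⟩

theorem SmoothOnStrip.hasDerivWithinAt (h : SmoothOnStrip (n + 1) T f) {t : ℝ}
    (ht : t ∈ Set.Icc 0 T) (x : ℝ) :
    HasDerivWithinAt (fun s => f s x) (dT T f t x) (Set.Icc 0 T) t :=
  (h.hasDerivWithinAt_fderivWithin ht x).differentiableWithinAt.hasDerivWithinAt

theorem SmoothOnStrip.hasDerivAt (h : SmoothOnStrip (n + 1) T f) {t : ℝ}
    (ht : t ∈ Set.Icc 0 T) (x : ℝ) : HasDerivAt (f t) (dX f t x) x :=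
  (h.hasDerivAt_fderivWithin ht x).differentiableAt.hasDerivAt

/-- For `0 < T` the closed strip has unique derivatives, so a directional derivative costs exactly
one order of smoothness, up to the boundary. -/
theorem SmoothOnStrip.contDiffOn_fderivWithin (hT : 0 < T) (h : SmoothOnStrip (n + 1) T f)
    (y : ℝ × ℝ) :
    ContDiffOn ℝ n (fun q => fderivWithin ℝ (fun p : ℝ × ℝ => f p.1 p.2)
      (Set.Icc 0 T ×ˢ Set.univ) q y) (Set.Icc 0 T ×ˢ Set.univ) :=
  (ContDiffOn.fderivWithin h ((uniqueDiffOn_Icc hT).prod uniqueDiffOn_univ)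
    (by norm_cast)).clm_apply contDiffOn_const

theorem SmoothOnStrip.dT (hT : 0 < T) (h : SmoothOnStrip (n + 1) T f) :
    SmoothOnStrip n T (dT T f) :=
  (h.contDiffOn_fderivWithin hT (1, 0)).congr fun p hp =>
    (h.hasDerivWithinAt_fderivWithin hp.1 p.2).derivWithin (uniqueDiffOn_Icc hT p.1 hp.1)

theorem SmoothOnStrip.dX (hT : 0 < T) (h : SmoothOnStrip (n + 1) T f) :
    SmoothOnStrip n T (dX f) :=
  (h.contDiffOn_fderivWithin hT (0, 1)).congr fun p hp =>
    (h.hasDerivAt_fderivWithin hp.1 p.2).deriv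

theorem SmoothOnStrip.exists_bound (h : SmoothOnStrip n T f) (R : ℝ) :
    ∃ B, ∀ t ∈ Set.Icc 0 T, ∀ x, |x| ≤ R → ‖f t x‖ ≤ B := by
  obtain ⟨B, hB⟩ := (isCompact_Icc.prod isCompact_Icc :
    IsCompact (Set.Icc 0 T ×ˢ Set.Icc (-R) R)).exists_bound_of_continuousOn
    ((ContDiffOn.continuousOn h).mono (Set.prod_mono le_rfl (Set.subset_univ _)))
  exact ⟨B, fun t ht x hx => hB (t, x) ⟨ht, abs_le.1 hx⟩⟩

theorem SmoothOnStrip.sq_norm {f : ℝ → ℝ → ℂ} (h : SmoothOnStrip n T f) :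
    SmoothOnStrip n T (fun t x => ‖f t x‖ ^ 2) :=
  ContDiffOn.norm_sq ℝ h

/-! ### Symmetric Taylor estimates -/

variable {g g₁ g₂ g₃ g₄ : ℝ → F} {a b t h B : ℝ}

theorem norm_sub_le_mul_of_hasDerivWithinAt (hab : a ≤ b)
    (hg : ∀ s ∈ Set.Icc a b, HasDerivWithinAt g (g₁ s) (Set.Icc a b) s)
    (hB : ∀ s ∈ Set.Icc a b, ‖g₁ s‖ ≤ B) : ‖g b - g a‖ ≤ B * (b - a) := by
  have := (convex_Icc a b).norm_image_sub_le_of_norm_hasDerivWithin_le hg hB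
    (Set.left_mem_Icc.2 hab) (Set.right_mem_Icc.2 hab)
  rwa [Real.norm_of_nonneg (by linarith)] at this

theorem hasDerivWithinAt_add_left (hg : ∀ s ∈ Set.Icc a b, HasDerivWithinAt g (g₁ s) (Set.Icc a b) s)
    (h2 : t + h ≤ b) (h1 : a ≤ t - h) {s : ℝ} (hs : s ∈ Set.Icc 0 h) :
    HasDerivWithinAt (fun s => g (t + s)) (g₁ (t + s)) (Set.Icc 0 h) s := by
  have hm : Set.MapsTo (fun s => t + s) (Set.Icc 0 h) (Set.Icc a b) := fun r hr => by
    constructor <;> linarith [hr.1, hr.2]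
  exact ((hg (t + s) (hm hs)).scomp s (((hasDerivAt_id s).const_add t).hasDerivWithinAt)
    hm).congr_deriv (one_smul _ _)

theorem hasDerivWithinAt_sub_left (hg : ∀ s ∈ Set.Icc a b, HasDerivWithinAt g (g₁ s) (Set.Icc a b) s)
    (h2 : t + h ≤ b) (h1 : a ≤ t - h) {s : ℝ} (hs : s ∈ Set.Icc 0 h) :
    HasDerivWithinAt (fun s => g (t - s)) (-g₁ (t - s)) (Set.Icc 0 h) s := by
  have hm : Set.MapsTo (fun s => t - s) (Set.Icc 0 h) (Set.Icc a b) := fun r hr => by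
    constructor <;> linarith [hr.1, hr.2]
  exact ((hg (t - s) (hm hs)).scomp s (((hasDerivAt_id s).const_sub t).hasDerivWithinAt)
    hm).congr_deriv (by simp)

/-- Regard the left side as a function of the half-width `s`. It vanishes at `0`, and its derivative
`g₁ (t + s) - g₁ (t - s)` is estimated by the mean value inequality. The next two estimates follow
in the same way, each from the preceding one applied to `g₁`; the constants are not sharp. -/
theorem norm_add_sub_two_smul_le (hh : 0 ≤ h) (h1 : a ≤ t - h) (h2 : t + h ≤ b)
    (hg : ∀ s ∈ Set.Icc a b, HasDerivWithinAt g (g₁ s) (Set.Icc a b) s)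
    (hg₁ : ∀ s ∈ Set.Icc a b, HasDerivWithinAt g₁ (g₂ s) (Set.Icc a b) s)
    (hB : ∀ s ∈ Set.Icc a b, ‖g₂ s‖ ≤ B) :
    ‖g (t + h) + g (t - h) - (2 : ℝ) • g t‖ ≤ 2 * B * h ^ 2 := by
  have hB0 : 0 ≤ B := (norm_nonneg _).trans (hB (t + h) ⟨by linarith, h2⟩)
  have key := norm_sub_le_mul_of_hasDerivWithinAt (B := 2 * B * h)
    (g := fun s => g (t + s) + g (t - s) - (2 : ℝ) • g t) (g₁ := fun s => g₁ (t + s) - g₁ (t - s)) hh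
    (fun s hs => by
      simpa [sub_eq_add_neg] using ((hasDerivWithinAt_add_left hg h2 h1 hs).add
        (hasDerivWithinAt_sub_left hg h2 h1 hs)).sub_const ((2 : ℝ) • g t))
    (fun s hs => by
      have hsub : Set.Icc (t - s) (t + s) ⊆ Set.Icc a b :=
        Set.Icc_subset_Icc (by linarith [hs.2]) (by linarith [hs.2])
      have := norm_sub_le_mul_of_hasDerivWithinAt (a := t - s) (b := t + s) (B := B)
        (by linarith [hs.1]) (fun r hr => (hg₁ r (hsub hr)).mono hsub) (fun r hr => hB r (hsub hr))
      refine this.trans ?_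
      have := mul_le_mul_of_nonneg_left hs.2 hB0
      linarith)
  have e : g (t + 0) + g (t - 0) - (2 : ℝ) • g t = 0 := by
    rw [add_zero, sub_zero]; module
  rw [e, sub_zero, sub_zero] at key
  exact key.trans (le_of_eq (by ring))

theorem norm_sub_sub_two_smul_le (hh : 0 ≤ h) (h1 : a ≤ t - h) (h2 : t + h ≤ b)
    (hg : ∀ s ∈ Set.Icc a b, HasDerivWithinAt g (g₁ s) (Set.Icc a b) s)
    (hg₁ : ∀ s ∈ Set.Icc a b, HasDerivWithinAt g₁ (g₂ s) (Set.Icc a b) s)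
    (hg₂ : ∀ s ∈ Set.Icc a b, HasDerivWithinAt g₂ (g₃ s) (Set.Icc a b) s)
    (hB : ∀ s ∈ Set.Icc a b, ‖g₃ s‖ ≤ B) :
    ‖g (t + h) - g (t - h) - (2 * h) • g₁ t‖ ≤ 2 * B * h ^ 3 := by
  have hB0 : 0 ≤ B := (norm_nonneg _).trans (hB (t + h) ⟨by linarith, h2⟩)
  have key := norm_sub_le_mul_of_hasDerivWithinAt (B := 2 * B * h ^ 2)
    (g := fun s => g (t + s) - g (t - s) - (2 * s) • g₁ t)
    (g₁ := fun s => g₁ (t + s) + g₁ (t - s) - (2 : ℝ) • g₁ t) hh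
    (fun s hs => by
      have hl : HasDerivWithinAt (fun s : ℝ => (2 * s) • g₁ t) ((2 : ℝ) • g₁ t) (Set.Icc 0 h) s := by
        simpa using (((hasDerivAt_id s).const_mul (2 : ℝ)).smul_const (g₁ t)).hasDerivWithinAt
      exact (((hasDerivWithinAt_add_left hg h2 h1 hs).sub
        (hasDerivWithinAt_sub_left hg h2 h1 hs)).sub hl).congr_deriv (by module))
    (fun s hs => by
      refine (norm_add_sub_two_smul_le (h := s) hs.1 (by linarith [hs.2]) (by linarith [hs.2])
        hg₁ hg₂ hB).trans ?_
      have := hs.1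
      have := hs.2
      gcongr)
  have e : g (t + 0) - g (t - 0) - (2 * 0 : ℝ) • g₁ t = 0 := by
    rw [add_zero, sub_zero]; module
  rw [e, sub_zero, sub_zero] at key
  exact key.trans (le_of_eq (by ring))

theorem norm_add_sub_two_smul_sub_sq_smul_le (hh : 0 ≤ h) (h1 : a ≤ t - h) (h2 : t + h ≤ b)
    (hg : ∀ s ∈ Set.Icc a b, HasDerivWithinAt g (g₁ s) (Set.Icc a b) s)
    (hg₁ : ∀ s ∈ Set.Icc a b, HasDerivWithinAt g₁ (g₂ s) (Set.Icc a b) s)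
    (hg₂ : ∀ s ∈ Set.Icc a b, HasDerivWithinAt g₂ (g₃ s) (Set.Icc a b) s)
    (hg₃ : ∀ s ∈ Set.Icc a b, HasDerivWithinAt g₃ (g₄ s) (Set.Icc a b) s)
    (hB : ∀ s ∈ Set.Icc a b, ‖g₄ s‖ ≤ B) :
    ‖g (t + h) + g (t - h) - (2 : ℝ) • g t - h ^ 2 • g₂ t‖ ≤ 2 * B * h ^ 4 := by
  have hB0 : 0 ≤ B := (norm_nonneg _).trans (hB (t + h) ⟨by linarith, h2⟩)
  have key := norm_sub_le_mul_of_hasDerivWithinAt (B := 2 * B * h ^ 3)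
    (g := fun s => g (t + s) + g (t - s) - (2 : ℝ) • g t - s ^ 2 • g₂ t)
    (g₁ := fun s => g₁ (t + s) - g₁ (t - s) - (2 * s) • g₂ t) hh
    (fun s hs => by
      have hl : HasDerivWithinAt (fun s : ℝ => s ^ 2 • g₂ t) ((2 * s) • g₂ t) (Set.Icc 0 h) s := by
        simpa using (((hasDerivAt_id s).pow 2).smul_const (g₂ t)).hasDerivWithinAt
      exact ((((hasDerivWithinAt_add_left hg h2 h1 hs).add
        (hasDerivWithinAt_sub_left hg h2 h1 hs)).sub_const ((2 : ℝ) • g t)).sub hl).congr_deriv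
          (by module))
    (fun s hs => by
      refine (norm_sub_sub_two_smul_le (h := s) hs.1 (by linarith [hs.2]) (by linarith [hs.2])
        hg₁ hg₂ hg₃ hB).trans ?_
      have := hs.1
      have := hs.2
      gcongr)
  have e : g (t + 0) + g (t - 0) - (2 : ℝ) • g t - (0 : ℝ) ^ 2 • g₂ t = 0 := by
    rw [add_zero, sub_zero]; module
  rw [e, sub_zero, sub_zero] at key
  exact key.trans (le_of_eq (by ring))

end

/-! ### Consistency of the difference operators -/

/-- On `[-R, R]` the function `G` is bounded by `c` and Lipschitz with constant `c`. -/
structure LipBound {F : Type*} [NormedAddCommGroup F] (R c : ℝ) (G : ℝ → F) : Prop where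
  bound : ∀ x, |x| ≤ R → ‖G x‖ ≤ c
  lip : ∀ x y, |x| ≤ R → |y| ≤ R → x ≤ y → ‖G y - G x‖ ≤ c * (y - x)

section

variable {F : Type*} [NormedAddCommGroup F] {R c c' : ℝ} {G H : ℝ → F}

theorem LipBound.mono (hG : LipBound R c G) (h : c ≤ c') : LipBound R c' G where
  bound x hx := (hG.bound x hx).trans h
  lip x y hx hy hxy := (hG.lip x y hx hy hxy).trans
    (mul_le_mul_of_nonneg_right h (sub_nonneg.2 hxy))

theorem LipBound.add (hG : LipBound R c G) (hH : LipBound R c' H) :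
    LipBound R (c + c') (fun x => G x + H x) where
  bound x hx := (norm_add_le _ _).trans (add_le_add (hG.bound x hx) (hH.bound x hx))
  lip x y hx hy hxy := by
    rw [add_sub_add_comm, add_mul]
    exact (norm_add_le _ _).trans (add_le_add (hG.lip x y hx hy hxy) (hH.lip x y hx hy hxy))

theorem LipBound.sub (hG : LipBound R c G) (hH : LipBound R c' H) :
    LipBound R (c + c') (fun x => G x - H x) where
  bound x hx := (norm_sub_le _ _).trans (add_le_add (hG.bound x hx) (hH.bound x hx))
  lip x y hx hy hxy := by
    rw [sub_sub_sub_comm, add_mul]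
    exact (norm_sub_le _ _).trans (add_le_add (hG.lip x y hx hy hxy) (hH.lip x y hx hy hxy))

variable [NormedSpace ℝ F]

theorem LipBound.const_smul (hG : LipBound R c G) (r : ℝ) :
    LipBound R (|r| * c) (fun x => r • G x) where
  bound x hx := by
    rw [norm_smul]
    exact mul_le_mul_of_nonneg_left (hG.bound x hx) (abs_nonneg r)
  lip x y hx hy hxy := by
    rw [← smul_sub, norm_smul, mul_assoc]
    exact mul_le_mul_of_nonneg_left (hG.lip x y hx hy hxy) (abs_nonneg r)

theorem LipBound.I_mul {G : ℝ → ℂ} (hG : LipBound R c G) :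
    LipBound R c (fun x => Complex.I * G x) where
  bound x hx := by simpa using hG.bound x hx
  lip x y hx hy hxy := by simpa [← mul_sub] using hG.lip x y hx hy hxy

theorem LipBound.smul {φ : ℝ → ℝ} (hφ : LipBound R c φ) (hG : LipBound R c' G) (hc : 0 ≤ c) :
    LipBound R (2 * c * c') (fun x => φ x • G x) where
  bound x hx := by
    rw [norm_smul]
    have h1 := mul_le_mul (hφ.bound x hx) (hG.bound x hx) (norm_nonneg _) hc
    have h2 : 0 ≤ c * c' := (by positivity : 0 ≤ ‖φ x‖ * ‖G x‖).trans h1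
    linarith
  lip x y hx hy hxy := by
    have e : φ y • G y - φ x • G x = φ y • (G y - G x) + (φ y - φ x) • G x := by module
    rw [e]
    refine (norm_add_le _ _).trans ?_
    rw [norm_smul, norm_smul]
    have h1 := mul_le_mul (hφ.bound y hy) (hG.lip x y hx hy hxy) (norm_nonneg _) hc
    have h2 := mul_le_mul (hφ.lip x y hx hy hxy) (hG.bound x hx) (norm_nonneg _)
      (mul_nonneg hc (sub_nonneg.2 hxy))
    linarith

/-- Divide a pointwise bound and a bound on differences by a positive number. -/
theorem LipBound.of_smul {r : ℝ} (hr : 0 < r) (hG : LipBound R (c * r) (fun x => r • G x)) :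
    LipBound R c G := by
  have h := hG.const_smul r⁻¹
  simp only [smul_smul, inv_mul_cancel₀ hr.ne', one_smul, abs_of_pos (inv_pos.2 hr)] at h
  exact h.mono (le_of_eq (by field_simp))

variable {T : ℝ} {f : ℝ → ℝ → F}

theorem SmoothOnStrip.exists_lipBound (hT : 0 < T) (hf : SmoothOnStrip 1 T f) (R : ℝ) :
    ∃ c, 0 ≤ c ∧ ∀ t ∈ Set.Icc 0 T, LipBound R c (f t) := by
  obtain ⟨c₀, h₀⟩ := hf.exists_bound R
  obtain ⟨c₁, h₁⟩ := (SmoothOnStrip.dX (n := 0) hT hf).exists_bound R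
  refine ⟨max 0 (max c₀ c₁), le_max_left _ _, fun t ht => ⟨fun x hx => (h₀ t ht x hx).trans
    (by simp), fun x y hx hy hxy => ?_⟩⟩
  refine norm_sub_le_mul_of_hasDerivWithinAt hxy (g₁ := Zakharov.dX f t)
    (fun s _ => (hf.hasDerivAt ht s).hasDerivWithinAt) fun s hs => (h₁ t ht s ?_).trans (by simp)
  rw [abs_le] at *
  constructor <;> linarith [hs.1, hs.2]

/-- The temporal average is second order accurate. -/
theorem SmoothOnStrip.exists_lipBound_mean (hT : 0 < T) (hf : SmoothOnStrip 3 T f) (R : ℝ) :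
    ∃ c, 0 ≤ c ∧ ∀ t h : ℝ, 0 ≤ h → 0 ≤ t - h → t + h ≤ T →
      LipBound R (c * h ^ 2) (fun x => (2⁻¹ : ℝ) • (f (t + h) x + f (t - h) x) - f t x) := by
  have hf1 := SmoothOnStrip.dT (n := 2) hT hf
  have hf2 := SmoothOnStrip.dT (n := 1) hT hf1
  -- Two derivatives go into the Taylor estimate, the third into the Lipschitz bound in `x`.
  obtain ⟨c, hc, hb⟩ := hf2.exists_lipBound hT R
  refine ⟨c, hc, fun t h hh h1 h2 => LipBound.of_smul two_pos ⟨fun x hx => ?_,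
    fun x y hx hy hxy => ?_⟩⟩
  · have := norm_add_sub_two_smul_le hh h1 h2
      (fun s hs => hf.hasDerivWithinAt hs x) (fun s hs => hf1.hasDerivWithinAt hs x)
      (fun s hs => (hb s hs).bound x hx)
    refine le_trans (le_of_eq (congrArg norm ?_)) (this.trans (le_of_eq (by ring)))
    module
  -- The Lipschitz part is the same Taylor estimate for the difference of `f` at `y` and `x`, whose
  -- derivatives are of size `y - x`.
  · have := norm_add_sub_two_smul_le (g := fun s => f s y - f s x) hh h1 h2
      (fun s hs => (hf.hasDerivWithinAt hs y).sub (hf.hasDerivWithinAt hs x))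
      (fun s hs => (hf1.hasDerivWithinAt hs y).sub (hf1.hasDerivWithinAt hs x))
      (fun s hs => (hb s hs).lip x y hx hy hxy)
    refine le_trans (le_of_eq (congrArg norm ?_)) (this.trans (le_of_eq (by ring)))
    module

/-- The temporal difference quotient is second order accurate at the midpoint. -/
theorem SmoothOnStrip.exists_lipBound_quotient (hT : 0 < T) (hf : SmoothOnStrip 4 T f) (R : ℝ) :
    ∃ c, 0 ≤ c ∧ ∀ t h : ℝ, 0 < h → 0 ≤ t - h → t + h ≤ T →
      LipBound R (c * h ^ 2)
        (fun x => (2 * h)⁻¹ • (f (t + h) x - f (t - h) x) - Zakharov.dT T f t x) := by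
  have hf1 := SmoothOnStrip.dT (n := 3) hT hf
  have hf2 := SmoothOnStrip.dT (n := 2) hT hf1
  have hf3 := SmoothOnStrip.dT (n := 1) hT hf2
  obtain ⟨c, hc, hb⟩ := hf3.exists_lipBound hT R
  refine ⟨c, hc, fun t h hh h1 h2 => LipBound.of_smul (r := 2 * h) (by positivity)
    ⟨fun x hx => ?_, fun x y hx hy hxy => ?_⟩⟩
  · have := norm_sub_sub_two_smul_le hh.le h1 h2
      (fun s hs => hf.hasDerivWithinAt hs x) (fun s hs => hf1.hasDerivWithinAt hs x)
      (fun s hs => hf2.hasDerivWithinAt hs x) (fun s hs => (hb s hs).bound x hx)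
    rw [smul_sub, smul_inv_smul₀ (by positivity)]
    exact this.trans (le_of_eq (by ring))
  · have := norm_sub_sub_two_smul_le (g := fun s => f s y - f s x) hh.le h1 h2
      (fun s hs => (hf.hasDerivWithinAt hs y).sub (hf.hasDerivWithinAt hs x))
      (fun s hs => (hf1.hasDerivWithinAt hs y).sub (hf1.hasDerivWithinAt hs x))
      (fun s hs => (hf2.hasDerivWithinAt hs y).sub (hf2.hasDerivWithinAt hs x))
      (fun s hs => (hb s hs).lip x y hx hy hxy)
    rw [smul_sub, smul_inv_smul₀ (by positivity), smul_sub (2 * h), smul_inv_smul₀ (by positivity)]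
    refine le_trans (le_of_eq (congrArg norm ?_)) (this.trans (le_of_eq (by ring)))
    module

/-- The second spatial difference is second order accurate. -/
theorem SmoothOnStrip.exists_lipBound_second (hT : 0 < T) (hf : SmoothOnStrip 5 T f) (R L : ℝ) :
    ∃ c, 0 ≤ c ∧ ∀ t ∈ Set.Icc 0 T, ∀ d : ℝ, 0 < d → d ≤ L →
      LipBound R (c * d ^ 2) (fun x => (d ^ 2)⁻¹ • (f t (x + d) - (2 : ℝ) • f t x + f t (x - d))
        - Zakharov.dX (Zakharov.dX f) t x) := by
  have hf1 := SmoothOnStrip.dX (n := 4) hT hf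
  have hf2 := SmoothOnStrip.dX (n := 3) hT hf1
  have hf3 := SmoothOnStrip.dX (n := 2) hT hf2
  have hf4 := SmoothOnStrip.dX (n := 1) hT hf3
  -- The stencil leaves `[-R, R]` by at most `d ≤ L`, so bounds are taken on the larger interval.
  obtain ⟨c, hc, hb⟩ := hf4.exists_lipBound hT (R + L)
  refine ⟨2 * c, by positivity, fun t ht d hd hdL => LipBound.of_smul (r := d ^ 2) (by positivity)
    ⟨fun x hx => ?_, fun x y hx hy hxy => ?_⟩⟩
  · have := norm_add_sub_two_smul_sub_sq_smul_le (t := x) (a := x - d) (b := x + d) hd.le le_rfl le_rfl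
      (fun s _ => (hf.hasDerivAt ht s).hasDerivWithinAt)
      (fun s _ => (hf1.hasDerivAt ht s).hasDerivWithinAt)
      (fun s _ => (hf2.hasDerivAt ht s).hasDerivWithinAt)
      (fun s _ => (hf3.hasDerivAt ht s).hasDerivWithinAt)
      (fun s hs => (hb t ht).bound s (by
        rw [abs_le] at *; constructor <;> linarith [hs.1, hs.2]))
    rw [smul_sub, smul_inv_smul₀ (by positivity)]
    refine le_trans (le_of_eq (congrArg norm ?_)) (this.trans (le_of_eq (by ring)))
    module
  · have hd' : ∀ {g g' : ℝ → F}, (∀ s, HasDerivAt g (g' s) s) → ∀ s,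
        HasDerivAt (fun s => g (s + (y - x)) - g s) (g' (s + (y - x)) - g' s) s :=
      fun hg s => ((hg (s + (y - x))).comp_add_const s (y - x)).sub (hg s)
    have := norm_add_sub_two_smul_sub_sq_smul_le (t := x) (a := x - d) (b := x + d)
      (g := fun s => f t (s + (y - x)) - f t s) (B := c * (y - x)) hd.le le_rfl le_rfl
      (fun s _ => (hd' (fun s => hf.hasDerivAt ht s) s).hasDerivWithinAt)
      (fun s _ => (hd' (fun s => hf1.hasDerivAt ht s) s).hasDerivWithinAt)
      (fun s _ => (hd' (fun s => hf2.hasDerivAt ht s) s).hasDerivWithinAt)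
      (fun s _ => (hd' (fun s => hf3.hasDerivAt ht s) s).hasDerivWithinAt)
      (fun s hs => ((hb t ht).lip s (s + (y - x))
        (by rw [abs_le] at *; constructor <;> linarith [hs.1, hs.2])
        (by rw [abs_le] at *; constructor <;> linarith [hs.1, hs.2]) (by linarith)).trans
          (le_of_eq (by ring)))
    rw [smul_sub, smul_inv_smul₀ (by positivity), smul_sub (d ^ 2), smul_inv_smul₀ (by positivity)]
    have e1 : x + d + (y - x) = y + d := by ring
    have e2 : x - d + (y - x) = y - d := by ring
    have e3 : x + (y - x) = y := by ring
    rw [e1, e2, e3] at this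
    refine le_trans (le_of_eq (congrArg norm ?_)) (this.trans (le_of_eq (by ring)))
    module

/-- The second spatial difference of the temporal average is second order accurate. -/
theorem SmoothOnStrip.exists_lipBound_second_mean (hT : 0 < T) (hf : SmoothOnStrip 5 T f)
    (R L : ℝ) :
    ∃ c, 0 ≤ c ∧ ∀ t h : ℝ, 0 ≤ h → 0 ≤ t - h → t + h ≤ T → ∀ d : ℝ, 0 < d → d ≤ L →
      LipBound R (c * (h ^ 2 + d ^ 2)) (fun x =>
        (d ^ 2)⁻¹ • ((2⁻¹ : ℝ) • (f (t + h) (x + d) + f (t - h) (x + d))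
          - (2 : ℝ) • ((2⁻¹ : ℝ) • (f (t + h) x + f (t - h) x))
          + (2⁻¹ : ℝ) • (f (t + h) (x - d) + f (t - h) (x - d)))
        - Zakharov.dX (Zakharov.dX f) t x) := by
  obtain ⟨c₁, hc₁, h₁⟩ := hf.exists_lipBound_second hT R L
  -- The error splits into the spatial error at the two times and the averaging error of `f_xx`,
  -- which is still of class `C³`.
  obtain ⟨c₂, hc₂, h₂⟩ := (SmoothOnStrip.dX (n := 3) hT
    (SmoothOnStrip.dX (n := 4) hT hf)).exists_lipBound_mean hT R
  refine ⟨c₁ + c₂, by positivity, fun t h hh ha hb d hd hdL => ?_⟩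
  have b1 := (h₁ (t + h) ⟨by linarith, hb⟩ d hd hdL).const_smul 2⁻¹
  have b2 := (h₁ (t - h) ⟨ha, by linarith⟩ d hd hdL).const_smul 2⁻¹
  have b3 := ((b1.add b2).add (h₂ t h hh ha hb)).mono (c' := (c₁ + c₂) * (h ^ 2 + d ^ 2)) (by
    rw [abs_of_pos (by positivity)]
    nlinarith [mul_nonneg hc₁ (sq_nonneg h), mul_nonneg hc₂ (sq_nonneg d)])
  convert b3 using 2 with x
  module

end

/-! ### Residuals of the exact solution -/

/-- At interior times the one-sided derivative is the ordinary one. Interior times suffice, because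
residuals are expanded at midpoints of time steps. -/
theorem IsSolution.eq_E_dT {T L : ℝ} {E : ℝ → ℝ → ℂ} {N V : ℝ → ℝ → ℝ}
    (hsol : IsSolution T L E N V) {t : ℝ} (ht : t ∈ Set.Ioo 0 T) (x : ℝ) :
    Complex.I * dT T E t x + dX (dX E) t x = N t x • E t x := by
  have h := hsol.eq_E t ht x
  rw [iteratedDeriv_succ, iteratedDeriv_one] at h
  rw [dT, derivWithin_of_mem_nhds (Icc_mem_nhds ht.1 ht.2), Complex.real_smul]
  exact h

theorem IsSolution.eq_N_dT {T L : ℝ} {E : ℝ → ℝ → ℂ} {N V : ℝ → ℝ → ℝ}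
    (hsol : IsSolution T L E N V) {t : ℝ} (ht : t ∈ Set.Ioo 0 T) (x : ℝ) :
    dT T N t x = dX (dX V) t x := by
  have h := hsol.eq_N t ht x
  rw [iteratedDeriv_succ, iteratedDeriv_one] at h
  rw [dT, derivWithin_of_mem_nhds (Icc_mem_nhds ht.1 ht.2)]
  exact h

theorem IsSolution.eq_V_dT {T L : ℝ} {E : ℝ → ℝ → ℂ} {N V : ℝ → ℝ → ℝ}
    (hsol : IsSolution T L E N V) {t : ℝ} (ht : t ∈ Set.Ioo 0 T) (x : ℝ) :
    dT T V t x = N t x + ‖E t x‖ ^ 2 := by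
  rw [dT, derivWithin_of_mem_nhds (Icc_mem_nhds ht.1 ht.2)]
  exact hsol.eq_V t ht x

/-- Residual of the Schrödinger equation of the scheme at the exact solution. -/
def residualE (dt dx : ℝ) (E : ℝ → ℝ → ℂ) (N : ℝ → ℝ → ℝ) (m : ℕ) (k : ℤ) : ℂ :=
  Complex.I * dtPlus dt (sample dt dx E) m k + dxTwo dx (mtPlus (sample dt dx E) m) k
    - ((mtPlus (sample dt dx N) m k : ℝ) : ℂ) * mtPlus (sample dt dx E) m k

/-- Residual of the equation for `N` of the scheme at the exact solution. -/
def residualN (dt dx : ℝ) (N V : ℝ → ℝ → ℝ) (m : ℕ) (k : ℤ) : ℝ :=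
  dtPlus dt (sample dt dx N) m k - dxTwo dx (mtPlus (sample dt dx V) m) k

/-- Residual of the equation for `V` of the scheme at the exact solution. -/
def residualV (dt dx : ℝ) (E : ℝ → ℝ → ℂ) (N V : ℝ → ℝ → ℝ) (m : ℕ) (k : ℤ) : ℝ :=
  dtPlus dt (sample dt dx V) m k - mtPlus (sample dt dx N) m k
    - mtPlus (sample dt dx fun t x => ‖E t x‖ ^ 2) m k

section

variable {F : Type*} [NormedAddCommGroup F] [NormedSpace ℝ F] {dt dx : ℝ}

/-- Recentring at `(m + 1/2) Δt` with half-step `Δt / 2` makes the quotient symmetric, hence second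
order accurate. -/
theorem dtPlus_sample (dt dx : ℝ) (f : ℝ → ℝ → F) (m : ℕ) (k : ℤ) :
    dtPlus dt (sample dt dx f) m k = (2 * (dt / 2))⁻¹ • (f ((m + 1 / 2) * dt + dt / 2) (k * dx)
      - f ((m + 1 / 2) * dt - dt / 2) (k * dx)) := by
  have e1 : ((m : ℝ) + 1 / 2) * dt + dt / 2 = ((m + 1 : ℕ) : ℝ) * dt := by push_cast; ring
  have e2 : ((m : ℝ) + 1 / 2) * dt - dt / 2 = m * dt := by ring
  rw [e1, e2, mul_div_cancel₀ _ two_ne_zero]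
  rfl

theorem mtPlus_sample (dt dx : ℝ) (f : ℝ → ℝ → F) (m : ℕ) (k : ℤ) :
    mtPlus (sample dt dx f) m k = (2⁻¹ : ℝ) • (f ((m + 1 / 2) * dt + dt / 2) (k * dx)
      + f ((m + 1 / 2) * dt - dt / 2) (k * dx)) := by
  have e1 : ((m : ℝ) + 1 / 2) * dt + dt / 2 = ((m + 1 : ℕ) : ℝ) * dt := by push_cast; ring
  have e2 : ((m : ℝ) + 1 / 2) * dt - dt / 2 = m * dt := by ring
  rw [e1, e2]
  rfl

theorem dxTwo_mtPlus_sample (dt dx : ℝ) (f : ℝ → ℝ → F) (m : ℕ) (k : ℤ) :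
    dxTwo dx (mtPlus (sample dt dx f) m) k = (dx ^ 2)⁻¹ •
      ((2⁻¹ : ℝ) • (f ((m + 1 / 2) * dt + dt / 2) (k * dx + dx)
          + f ((m + 1 / 2) * dt - dt / 2) (k * dx + dx))
        - (2 : ℝ) • ((2⁻¹ : ℝ) • (f ((m + 1 / 2) * dt + dt / 2) (k * dx)
          + f ((m + 1 / 2) * dt - dt / 2) (k * dx)))
        + (2⁻¹ : ℝ) • (f ((m + 1 / 2) * dt + dt / 2) (k * dx - dx)
          + f ((m + 1 / 2) * dt - dt / 2) (k * dx - dx))) := by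
  have e1 : ((k + 1 : ℤ) : ℝ) * dx = k * dx + dx := by push_cast; ring
  have e2 : ((k - 1 : ℤ) : ℝ) * dx = k * dx - dx := by push_cast; ring
  simp only [dxTwo, mtPlus_sample, e1, e2]

/-- A Lipschitz constant bounds the difference quotient. The radius `2 * L` is needed because the
quotient at `k = K` reaches the node `K + 1`. -/
theorem LipBound.norm_sample_le {L c : ℝ} {K : ℕ} {G : ℝ → F} (hdx : 0 < dx)
    (hL : (K : ℝ) * dx = L) (hG : LipBound (2 * L) c G) {g : ℤ → F} (hg : ∀ k : ℤ, g k = G (k * dx))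
    {k : ℤ} (hk : k ∈ Finset.Icc (1 : ℤ) (K : ℤ)) : ‖g k‖ ≤ c ∧ ‖dxPlus dx g k‖ ≤ c := by
  rw [Finset.mem_Icc] at hk
  have k1 : (1 : ℝ) ≤ k := by exact_mod_cast hk.1
  have k2 : (k : ℝ) ≤ K := by exact_mod_cast hk.2
  have b1 : dx ≤ k * dx := le_mul_of_one_le_left hdx.le k1
  have b2 : k * dx ≤ L := by rw [← hL]; gcongr
  have h1 : |(k : ℝ) * dx| ≤ 2 * L := by rw [abs_le]; constructor <;> linarith
  have h2 : |((k + 1 : ℤ) : ℝ) * dx| ≤ 2 * L := by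
    push_cast; rw [abs_le]; constructor <;> linarith
  refine ⟨by rw [hg]; exact hG.bound _ h1, ?_⟩
  have h3 := hG.lip _ _ h1 h2 (by push_cast; linarith)
  rw [dxPlus, norm_smul, norm_inv, Real.norm_of_nonneg hdx.le, inv_mul_le_iff₀ hdx, hg, hg]
  refine h3.trans (le_of_eq ?_)
  push_cast; ring

theorem SmoothOnStrip.exists_norm_sub_le {T : ℝ} {f : ℝ → ℝ → F} (hT : 0 < T)
    (hf : SmoothOnStrip 1 T f) (R : ℝ) :
    ∃ c, 0 ≤ c ∧ ∀ s t : ℝ, 0 ≤ s → s ≤ t → t ≤ T → ∀ x, |x| ≤ R →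
      ‖f t x - f s x‖ ≤ c * (t - s) := by
  obtain ⟨c, hc⟩ := (SmoothOnStrip.dT (n := 0) hT hf).exists_bound R
  refine ⟨max 0 c, le_max_left _ _, fun s t hs hst ht x hx => ?_⟩
  have hsub : Set.Icc s t ⊆ Set.Icc 0 T := Set.Icc_subset_Icc hs ht
  exact norm_sub_le_mul_of_hasDerivWithinAt (g := fun r => f r x) hst
    (fun r hr => (hf.hasDerivWithinAt (hsub hr) x).mono hsub)
    (fun r hr => (hc r (hsub hr) x hx).trans (le_max_right _ _))

end

section

variable {T L : ℝ} {E : ℝ → ℝ → ℂ} {N V : ℝ → ℝ → ℝ}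

/-- Subtract the differential equation at time `t` and split the product error as `μN μE - N E = (μN
- N) μE + N (μE - E)`. -/
theorem IsSolution.exists_lipBound_residualE (hT : 0 < T) (hsol : IsSolution T L E N V)
    (hE : SmoothOnStrip 5 T E) (hN : SmoothOnStrip 5 T N) (R : ℝ) :
    ∃ c, 0 ≤ c ∧ ∀ t h d : ℝ, 0 < h → 0 ≤ t - h → t + h ≤ T → 0 < d → d ≤ L →
      LipBound R (c * (h ^ 2 + d ^ 2)) (fun x =>
        Complex.I * ((2 * h)⁻¹ • (E (t + h) x - E (t - h) x))
        + (d ^ 2)⁻¹ • ((2⁻¹ : ℝ) • (E (t + h) (x + d) + E (t - h) (x + d))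
          - (2 : ℝ) • ((2⁻¹ : ℝ) • (E (t + h) x + E (t - h) x))
          + (2⁻¹ : ℝ) • (E (t + h) (x - d) + E (t - h) (x - d)))
        - ((2⁻¹ : ℝ) • (N (t + h) x + N (t - h) x))
          • ((2⁻¹ : ℝ) • (E (t + h) x + E (t - h) x))) := by
  obtain ⟨c₁, hc₁, h₁⟩ := (hE.of_le (by norm_num : 4 ≤ 5)).exists_lipBound_quotient hT R
  obtain ⟨c₂, hc₂, h₂⟩ := hE.exists_lipBound_second_mean hT R L
  obtain ⟨c₃, hc₃, h₃⟩ := (hN.of_le (by norm_num : 3 ≤ 5)).exists_lipBound_mean hT R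
  obtain ⟨c₄, hc₄, h₄⟩ := (hE.of_le (by norm_num : 3 ≤ 5)).exists_lipBound_mean hT R
  obtain ⟨c₅, hc₅, h₅⟩ := (hE.of_le (by norm_num : 1 ≤ 5)).exists_lipBound hT R
  obtain ⟨c₆, hc₆, h₆⟩ := (hN.of_le (by norm_num : 1 ≤ 5)).exists_lipBound hT R
  refine ⟨c₁ + c₂ + (2 * c₃ * c₅ + 2 * c₆ * c₄), by positivity, fun t h d hh ha hb hd hdL => ?_⟩
  have m1 : t + h ∈ Set.Icc 0 T := ⟨by linarith, hb⟩
  have m2 : t - h ∈ Set.Icc 0 T := ⟨ha, by linarith⟩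
  have m0 : t ∈ Set.Ioo 0 T := ⟨by linarith, by linarith⟩
  have b1 := (h₁ t h hh ha hb).I_mul
  have b2 := h₂ t h hh.le ha hb d hd hdL
  have b5 := ((h₅ _ m1).add (h₅ _ m2)).const_smul 2⁻¹
  have b3 := (h₃ t h hh.le ha hb).smul b5 (by positivity)
  have b4 := (h₆ t ⟨m0.1.le, m0.2.le⟩).smul (h₄ t h hh.le ha hb) hc₆
  have b := ((b1.add b2).sub (b3.add b4)).mono
    (c' := (c₁ + c₂ + (2 * c₃ * c₅ + 2 * c₆ * c₄)) * (h ^ 2 + d ^ 2)) (by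
      rw [abs_of_pos (by positivity)]
      have := mul_nonneg hc₁ (sq_nonneg d)
      have := mul_nonneg (mul_nonneg hc₃ hc₅) (sq_nonneg d)
      have := mul_nonneg (mul_nonneg hc₆ hc₄) (sq_nonneg d)
      linarith)
  convert b using 2 with x
  have e := hsol.eq_E_dT m0 x
  simp only [Complex.real_smul] at e ⊢
  push_cast [smul_eq_mul]
  linear_combination e

theorem IsSolution.exists_lipBound_residualN (hT : 0 < T) (hsol : IsSolution T L E N V)
    (hN : SmoothOnStrip 5 T N) (hV : SmoothOnStrip 5 T V) (R : ℝ) :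
    ∃ c, 0 ≤ c ∧ ∀ t h d : ℝ, 0 < h → 0 ≤ t - h → t + h ≤ T → 0 < d → d ≤ L →
      LipBound R (c * (h ^ 2 + d ^ 2)) (fun x => (2 * h)⁻¹ • (N (t + h) x - N (t - h) x)
        - (d ^ 2)⁻¹ • ((2⁻¹ : ℝ) • (V (t + h) (x + d) + V (t - h) (x + d))
          - (2 : ℝ) • ((2⁻¹ : ℝ) • (V (t + h) x + V (t - h) x))
          + (2⁻¹ : ℝ) • (V (t + h) (x - d) + V (t - h) (x - d)))) := by
  obtain ⟨c₁, hc₁, h₁⟩ := (hN.of_le (by norm_num : 4 ≤ 5)).exists_lipBound_quotient hT R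
  obtain ⟨c₂, hc₂, h₂⟩ := hV.exists_lipBound_second_mean hT R L
  refine ⟨c₁ + c₂, by positivity, fun t h d hh ha hb hd hdL => ?_⟩
  have m0 : t ∈ Set.Ioo 0 T := ⟨by linarith, by linarith⟩
  have b := ((h₁ t h hh ha hb).sub (h₂ t h hh.le ha hb d hd hdL)).mono
    (c' := (c₁ + c₂) * (h ^ 2 + d ^ 2)) (by linarith [mul_nonneg hc₁ (sq_nonneg d)])
  convert b using 2 with x
  rw [hsol.eq_N_dT m0 x, sub_sub_sub_cancel_right]

theorem IsSolution.exists_lipBound_residualV (hT : 0 < T) (hsol : IsSolution T L E N V)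
    (hE : SmoothOnStrip 5 T E) (hN : SmoothOnStrip 5 T N) (hV : SmoothOnStrip 5 T V) (R : ℝ) :
    ∃ c, 0 ≤ c ∧ ∀ t h : ℝ, 0 < h → 0 ≤ t - h → t + h ≤ T →
      LipBound R (c * h ^ 2) (fun x => (2 * h)⁻¹ • (V (t + h) x - V (t - h) x)
        - (2⁻¹ : ℝ) • (N (t + h) x + N (t - h) x)
        - (2⁻¹ : ℝ) • (‖E (t + h) x‖ ^ 2 + ‖E (t - h) x‖ ^ 2)) := by
  obtain ⟨c₁, hc₁, h₁⟩ := (hV.of_le (by norm_num : 4 ≤ 5)).exists_lipBound_quotient hT R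
  obtain ⟨c₂, hc₂, h₂⟩ := (hN.of_le (by norm_num : 3 ≤ 5)).exists_lipBound_mean hT R
  obtain ⟨c₃, hc₃, h₃⟩ := (hE.of_le (by norm_num : 3 ≤ 5)).sq_norm.exists_lipBound_mean hT R
  refine ⟨c₁ + c₂ + c₃, by positivity, fun t h hh ha hb => ?_⟩
  have m0 : t ∈ Set.Ioo 0 T := ⟨by linarith, by linarith⟩
  have b := (((h₁ t h hh ha hb).sub (h₂ t h hh.le ha hb)).sub (h₃ t h hh.le ha hb)).mono
    (c' := (c₁ + c₂ + c₃) * h ^ 2) (by linarith)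
  convert b using 2 with x
  rw [hsol.eq_V_dT m0 x]
  ring

/-- The scheme is consistent of second order, uniformly in the discrete `W^{1,∞}` norm. -/
theorem IsSolution.exists_residual_le (hT : 0 < T) (hsol : IsSolution T L E N V)
    (hE : SmoothOnStrip 5 T E) (hN : SmoothOnStrip 5 T N) (hV : SmoothOnStrip 5 T V) :
    ∃ c, 0 ≤ c ∧ ∀ (M K : ℕ) (dt dx : ℝ), 0 < dt → 0 < dx → (M : ℝ) * dt = T →
      (K : ℝ) * dx = L → ∀ m < M, ∀ k ∈ Finset.Icc (1 : ℤ) (K : ℤ),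
        ‖residualE dt dx E N m k‖ ≤ c * (dt ^ 2 + dx ^ 2) ∧
        ‖dxPlus dx (residualE dt dx E N m) k‖ ≤ c * (dt ^ 2 + dx ^ 2) ∧
        ‖residualN dt dx N V m k‖ ≤ c * (dt ^ 2 + dx ^ 2) ∧
        ‖dxPlus dx (residualV dt dx E N V m) k‖ ≤ c * (dt ^ 2 + dx ^ 2) := by
  obtain ⟨c₁, hc₁, h₁⟩ := hsol.exists_lipBound_residualE hT hE hN (2 * L)
  obtain ⟨c₂, hc₂, h₂⟩ := hsol.exists_lipBound_residualN hT hN hV (2 * L)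
  obtain ⟨c₃, hc₃, h₃⟩ := hsol.exists_lipBound_residualV hT hE hN hV (2 * L)
  refine ⟨c₁ + c₂ + c₃, by positivity, fun M K dt dx hdt hdx hM hK m hm k hk => ?_⟩
  have hmM : ((m + 1 : ℕ) : ℝ) ≤ M := by exact_mod_cast hm
  push_cast at hmM
  have hm1 : ((m : ℝ) + 1) * dt ≤ T := by rw [← hM]; gcongr
  have hm0 : 0 ≤ (m : ℝ) * dt := by positivity
  have hdxL : dx ≤ L := by
    have : (1 : ℝ) ≤ K := by
      rw [Finset.mem_Icc] at hk
      exact_mod_cast hk.1.trans hk.2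
    rw [← hK]; exact le_mul_of_one_le_left hdx.le this
  have ha : 0 ≤ ((m : ℝ) + 1 / 2) * dt - dt / 2 := by linarith
  have hb : ((m : ℝ) + 1 / 2) * dt + dt / 2 ≤ T := by linarith
  have hh : 0 < dt / 2 := by positivity
  have hle : ∀ c', 0 ≤ c' → c' ≤ c₁ + c₂ + c₃ →
      c' * ((dt / 2) ^ 2 + dx ^ 2) ≤ (c₁ + c₂ + c₃) * (dt ^ 2 + dx ^ 2) := by
    intro c' hc' hcc
    have : (dt / 2) ^ 2 + dx ^ 2 ≤ dt ^ 2 + dx ^ 2 := by linarith [sq_nonneg dt, div_pow dt 2 2]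
    exact mul_le_mul hcc this (by positivity) (by positivity)
  have b1 := ((h₁ _ _ _ hh ha hb hdx hdxL).mono (hle c₁ hc₁ (by linarith))).norm_sample_le hdx hK
    (g := residualE dt dx E N m) (fun k => by
      rw [residualE, dtPlus_sample, dxTwo_mtPlus_sample, mtPlus_sample, mtPlus_sample,
        ← Complex.real_smul]) hk
  have b2 := ((h₂ _ _ _ hh ha hb hdx hdxL).mono (hle c₂ hc₂ (by linarith))).norm_sample_le hdx hK
    (g := residualN dt dx N V m) (fun k => by
      rw [residualN, dtPlus_sample, dxTwo_mtPlus_sample]) hk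
  have b3 := ((h₃ _ _ hh ha hb).mono (c' := (c₁ + c₂ + c₃) * (dt ^ 2 + dx ^ 2))
    (le_trans (mul_le_mul_of_nonneg_left (le_add_of_nonneg_right (sq_nonneg dx)) hc₃)
      (hle c₃ hc₃ (by linarith)))).norm_sample_le hdx hK
    (g := residualV dt dx E N V m) (fun k => by
      rw [residualV, dtPlus_sample, mtPlus_sample, mtPlus_sample]) hk
  exact ⟨b1.1, b1.2, b2.1, b3.2⟩

end

/-! ### The error equations -/

section

variable {F : Type*} [NormedAddCommGroup F] [NormedSpace ℝ F]

theorem dtPlus_sub (dt : ℝ) (u u' : ℕ → ℤ → F) (m : ℕ) (k : ℤ) :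
    dtPlus dt (u - u') m k = dtPlus dt u m k - dtPlus dt u' m k := by
  simp only [dtPlus, Pi.sub_apply]; module

theorem mtPlus_sub (u u' : ℕ → ℤ → F) (m : ℕ) (k : ℤ) :
    mtPlus (u - u') m k = mtPlus u m k - mtPlus u' m k := by
  simp only [mtPlus, Pi.sub_apply]; module

theorem dxTwo_mtPlus_sub (dx : ℝ) (u u' : ℕ → ℤ → F) (m : ℕ) (k : ℤ) :
    dxTwo dx (mtPlus (u - u') m) k = dxTwo dx (mtPlus u m) k - dxTwo dx (mtPlus u' m) k := by
  simp only [dxTwo, mtPlus_sub]; module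

theorem dxTwo_periodic {K : ℕ} {u : ℤ → F} (hu : ∀ k, u (k + K) = u k) (dx : ℝ) (k : ℤ) :
    dxTwo dx u (k + K) = dxTwo dx u k := by
  simp only [dxTwo, add_right_comm k (K : ℤ) 1, add_sub_right_comm k (K : ℤ) 1, hu]

theorem dtPlus_periodic {K m : ℕ} {u : ℕ → ℤ → F} (h0 : ∀ k, u m (k + K) = u m k)
    (h1 : ∀ k, u (m + 1) (k + K) = u (m + 1) k) (dt : ℝ) (k : ℤ) :
    dtPlus dt u m (k + K) = dtPlus dt u m k := by
  simp [dtPlus, h0, h1]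

end

theorem sample_periodic {F : Type*} {T L dt dx : ℝ} {f : ℝ → ℝ → F} {M K m : ℕ} (hdt : 0 ≤ dt)
    (hM : (M : ℝ) * dt = T) (hK : (K : ℝ) * dx = L)
    (hf : ∀ t ∈ Set.Icc 0 T, ∀ x, f t (x + L) = f t x) (hm : m ≤ M) (k : ℤ) :
    sample dt dx f m (k + K) = sample dt dx f m k := by
  have h : (m : ℝ) * dt ∈ Set.Icc 0 T := ⟨by positivity, by rw [← hM]; gcongr⟩
  rw [sample, sample, ← hf _ h (k * dx), ← hK]
  push_cast; ring_nf

section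

variable {T L dt dx : ℝ} {M K : ℕ} {E : ℝ → ℝ → ℂ} {N V : ℝ → ℝ → ℝ}
  {Eₕ : ℕ → ℤ → ℂ} {Nₕ Vₕ : ℕ → ℤ → ℝ}

/-- With zero reference the relative energy is the energy of the scheme itself; this instance feeds
the a priori bound. -/
theorem IsDVDM.isPerturbedStep_zero (h : IsDVDM dt dx M K Eₕ Nₕ Vₕ) {m : ℕ} (hm : m < M) :
    IsPerturbedStep dt dx K m Eₕ 0 Nₕ Vₕ 0 0 0 0 where
  periodic_a := h.periodic_E m hm.le
  periodic_a_succ := h.periodic_E (m + 1) hm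
  periodic_v := h.periodic_V m hm.le
  periodic_v_succ := h.periodic_V (m + 1) hm
  periodic_rE _ := rfl
  periodic_rV _ := rfl
  eq_a k := by
    rw [h.eq_E m hm k]
    have e1 : mtPlus (0 : ℕ → ℤ → ℂ) m k = 0 := by simp [mtPlus]
    have e2 : mtPlus (0 : ℕ → ℤ → ℝ) m k = 0 := by simp [mtPlus]
    rw [e1, e2]
    simp
  eq_n k := by rw [h.eq_N m hm k]; simp
  eq_v k := by rw [h.eq_V m hm k]; simp

/-- Subtract the two sets of equations and expand the products about the exact solution; in
particular `|w + a|² - |w|² = |a|² + 2 Re(w̄ a)`. -/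
theorem IsDVDM.isPerturbedStep_error (hdt : 0 ≤ dt) (hM : (M : ℝ) * dt = T)
    (hK : (K : ℝ) * dx = L) (hsol : IsSolution T L E N V) (h : IsDVDM dt dx M K Eₕ Nₕ Vₕ)
    {m : ℕ} (hm : m < M) :
    IsPerturbedStep dt dx K m (Eₕ - sample dt dx E) (sample dt dx E) (Nₕ - sample dt dx N)
      (Vₕ - sample dt dx V) (sample dt dx N) (residualE dt dx E N m) (residualN dt dx N V m)
      (residualV dt dx E N V m) := by
  have pE : ∀ {j}, j ≤ M → ∀ k, sample dt dx E j (k + K) = sample dt dx E j k :=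
    sample_periodic hdt hM hK hsol.periodic_E
  have pN : ∀ {j}, j ≤ M → ∀ k, sample dt dx N j (k + K) = sample dt dx N j k :=
    sample_periodic hdt hM hK hsol.periodic_N
  have pV : ∀ {j}, j ≤ M → ∀ k, sample dt dx V j (k + K) = sample dt dx V j k :=
    sample_periodic hdt hM hK hsol.periodic_V
  have pQ : ∀ {j}, j ≤ M → ∀ k, sample dt dx (fun t x => ‖E t x‖ ^ 2) j (k + K)
      = sample dt dx (fun t x => ‖E t x‖ ^ 2) j k :=
    sample_periodic hdt hM hK fun t ht x => by rw [hsol.periodic_E t ht]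
  have hm' : m + 1 ≤ M := hm
  refine ⟨fun k => ?_, fun k => ?_, fun k => ?_, fun k => ?_, fun k => ?_, fun k => ?_,
    fun k => ?_, fun k => ?_, fun k => ?_⟩
  · simp only [Pi.sub_apply, h.periodic_E m hm.le, pE hm.le]
  · simp only [Pi.sub_apply, h.periodic_E _ hm', pE hm']
  · simp only [Pi.sub_apply, h.periodic_V m hm.le, pV hm.le]
  · simp only [Pi.sub_apply, h.periodic_V _ hm', pV hm']
  · rw [residualE, residualE, dtPlus_periodic (pE hm.le) (pE hm'),
      dxTwo_periodic (mtPlus_periodic (pE hm.le) (pE hm')), mtPlus_periodic (pN hm.le) (pN hm'),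
      mtPlus_periodic (pE hm.le) (pE hm')]
  · rw [residualV, residualV, dtPlus_periodic (pV hm.le) (pV hm'),
      mtPlus_periodic (pN hm.le) (pN hm'), mtPlus_periodic (pQ hm.le) (pQ hm')]
  · have e := h.eq_E m hm k
    rw [dtPlus_sub, dxTwo_mtPlus_sub, mtPlus_sub, mtPlus_sub, residualE]
    push_cast
    linear_combination e
  · rw [dtPlus_sub, dxTwo_mtPlus_sub, residualN, h.eq_N m hm k]
    ring
  · have e : mtPlus (fun j l => ‖(Eₕ - sample dt dx E) j l‖ ^ 2
          + 2 * ((sample dt dx E j l).re * ((Eₕ - sample dt dx E) j l).re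
            + (sample dt dx E j l).im * ((Eₕ - sample dt dx E) j l).im)) m k
        = mtPlus (fun j l => ‖Eₕ j l‖ ^ 2) m k
          - mtPlus (sample dt dx fun t x => ‖E t x‖ ^ 2) m k := by
      rw [← mtPlus_sub]
      congr 1
      funext j l
      have hs : sample dt dx (fun t x => ‖E t x‖ ^ 2) j l = ‖sample dt dx E j l‖ ^ 2 := rfl
      simp only [Pi.sub_apply]
      rw [hs]
      simp only [sq_norm_complex, Complex.sub_re, Complex.sub_im]
      ring
    rw [e, dtPlus_sub, mtPlus_sub, residualV, h.eq_V m hm k]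
    ring

/-- Bounds on the initial mass and energy of the scheme. -/
theorem initial_mass_energy_le {cE cN cV CV : ℝ} (hdx : 0 < dx) (hdxL : dx ≤ L)
    (hK : (K : ℝ) * dx = L) {u : ℤ → ℂ} {ν ψ ψ' : ℤ → ℝ}
    (hu : ∀ k ∈ Finset.Icc (1 : ℤ) (K : ℤ), ‖u k‖ ≤ cE ∧ ‖dxPlus dx u k‖ ≤ cE)
    (hν : ∀ k ∈ Finset.Icc (1 : ℤ) (K : ℤ), ‖ν k‖ ≤ cN)
    (hψ' : ∀ k ∈ Finset.Icc (1 : ℤ) (K : ℤ), ‖dxPlus dx ψ' k‖ ≤ cV)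
    (hψ : meshNorm dx K (dxPlus dx fun k => ψ k - ψ' k) ≤ CV * dx ^ 2) :
    meshSum dx K (fun k => ‖u k‖ ^ 2) ≤ L * cE ^ 2 ∧
    meshSum dx K (energyDensity dx u 0 ν ψ 0)
      ≤ L * (cE ^ 2 + cN ^ 2 / 2 + cN * cE ^ 2 + cV ^ 2) + CV ^ 2 * L ^ 4 := by
  constructor
  · rw [← hK, ← meshSum_const]
    exact meshSum_mono hdx.le fun k hk => pow_le_pow_left₀ (norm_nonneg _) (hu k hk).1 2
  · have h1 : meshSum dx K (fun k => ‖dxPlus dx (fun k => ψ k - ψ' k) k‖ ^ 2) ≤ CV ^ 2 * L ^ 4 := by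
      rw [← meshNorm_sq hdx.le]
      refine (pow_le_pow_left₀ (Real.sqrt_nonneg _) hψ 2).trans ?_
      rw [mul_pow, ← pow_mul]
      gcongr
    refine le_trans ?_ (add_le_add_right h1 _)
    rw [← hK, ← meshSum_const, ← meshSum_add]
    refine meshSum_mono hdx.le fun k hk => ?_
    have a1 := pow_le_pow_left₀ (norm_nonneg _) (hu k hk).1 2
    have a2 := pow_le_pow_left₀ (norm_nonneg _) (hu k hk).2 2
    have a3 := pow_le_pow_left₀ (norm_nonneg _) (hν k hk) 2
    have a4 := pow_le_pow_left₀ (norm_nonneg _) (hψ' k hk) 2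
    have a5 : ν k * ‖u k‖ ^ 2 ≤ cN * cE ^ 2 :=
      mul_le_mul ((le_abs_self _).trans (hν k hk)) a1 (sq_nonneg _)
        ((norm_nonneg _).trans (hν k hk))
    have a6 : dxPlus dx ψ k = dxPlus dx (fun k => ψ k - ψ' k) k + dxPlus dx ψ' k := by
      simp only [dxPlus, smul_eq_mul]; ring
    simp only [energyDensity, Pi.zero_apply, Complex.zero_re, Complex.zero_im, zero_mul, add_zero,
      mul_zero]
    rw [Real.norm_eq_abs, sq_abs] at a3 a4 ⊢
    rw [a6]
    -- The factor `1/2` in the energy absorbs the `2` of `(x + y)² ≤ 2x² + 2y²`.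
    nlinarith [sq_nonneg (dxPlus dx (fun k => ψ k - ψ' k) k - dxPlus dx ψ' k)]

end

/-! ### The convergence estimate -/

/-- The scheme converges with second order in the norm of the error functional. -/
theorem IsSolution.exists_errorFunctional_le {T L : ℝ} (hT : 0 < T) (hL : 0 < L)
    {E : ℝ → ℝ → ℂ} {N V : ℝ → ℝ → ℝ} (hsol : IsSolution T L E N V)
    (hE : SmoothOnStrip 5 T E) (hN : SmoothOnStrip 5 T N) (hV : SmoothOnStrip 5 T V) (CV : ℝ) :
    ∃ D : ℝ, 0 ≤ D ∧ ∃ ε : ℝ, 0 < ε ∧ ∀ (M K : ℕ) (dt dx : ℝ), 0 < dt → 0 < dx →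
      (M : ℝ) * dt = T → (K : ℝ) * dx = L → dt < ε →
      ∀ (Eₕ : ℕ → ℤ → ℂ) (Nₕ Vₕ : ℕ → ℤ → ℝ), IsDVDM dt dx M K Eₕ Nₕ Vₕ →
        Eₕ 0 = sample dt dx E 0 → Nₕ 0 = sample dt dx N 0 →
        meshNorm dx K (dxPlus dx (fun k => Vₕ 0 k - sample dt dx V 0 k)) ≤ CV * dx ^ 2 →
        ∀ m ≤ M, errorFunctional dx K (Eₕ m - sample dt dx E m) (Nₕ m - sample dt dx N m)
          (Vₕ m - sample dt dx V m) ≤ D * (dt ^ 2 + dx ^ 2) ^ 2 := by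
  obtain ⟨cE, hcE, bE⟩ := (hE.of_le (by norm_num : 1 ≤ 5)).exists_lipBound hT (2 * L)
  obtain ⟨cN, hcN, bN⟩ := (hN.of_le (by norm_num : 1 ≤ 5)).exists_lipBound hT (2 * L)
  obtain ⟨cV, hcV, bV⟩ := (hV.of_le (by norm_num : 1 ≤ 5)).exists_lipBound hT (2 * L)
  obtain ⟨dE, hdE, tE⟩ := (hE.of_le (by norm_num : 1 ≤ 5)).exists_norm_sub_le hT (2 * L)
  obtain ⟨dN, hdN, tN⟩ := (hN.of_le (by norm_num : 1 ≤ 5)).exists_norm_sub_le hT (2 * L)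
  obtain ⟨cR, hcR, bR⟩ := hsol.exists_residual_le hT hE hN hV
  set μ₀ := L * cE ^ 2
  set h₀ := L * (cE ^ 2 + cN ^ 2 / 2 + cN * cE ^ 2 + cV ^ 2) + CV ^ 2 * L ^ 4
  set S := L⁻¹ * μ₀ + μ₀ + (2 * h₀ + L⁻¹ * μ₀ ^ 2 + μ₀ ^ 3)
  -- One constant dominates the exact `E` and `N`, their time quotients and, through `cE + √S`, the
  -- error in `E`. The summand `1` gives `B ≥ 1`.
  set B := 1 + cE + cN + dE + dN + √S
  have hS := Real.sqrt_nonneg S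
  have hB : 1 ≤ B := by linarith
  -- The `4` is the coercivity factor, the exponential is the Gronwall growth up to time `T`, `CV ^
  -- 2 / 2` comes from the initial energy and `L * cR ^ 2` from the residuals. The threshold on `dt`
  -- makes the Gronwall parameter at most `1/2`.
  refine ⟨4 * (Real.exp (480 * B ^ 4 * T) * (CV ^ 2 / 2 + L * cR ^ 2)), by positivity,
    1 / (240 * B ^ 4), by positivity, ?_⟩
  intro M K dt dx hdt hdx hM hK hε Eₕ Nₕ Vₕ hD hE0 hN0 hV0
  have hKpos : 0 < K := by
    rcases Nat.eq_zero_or_pos K with rfl | h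
    · simp at hK; linarith
    · exact h
  have hdxL : dx ≤ L := by
    rw [← hK]; exact le_mul_of_one_le_left hdx.le (by exact_mod_cast hKpos)
  have hmem : ∀ {m : ℕ}, m ≤ M → (m : ℝ) * dt ∈ Set.Icc 0 T := fun {m} hm =>
    ⟨by positivity, by rw [← hM]; gcongr⟩
  have sE : ∀ m ≤ M, ∀ k ∈ Finset.Icc (1 : ℤ) (K : ℤ), ‖sample dt dx E m k‖ ≤ cE
      ∧ ‖dxPlus dx (sample dt dx E m) k‖ ≤ cE := fun m hm k hk =>
    (bE _ (hmem hm)).norm_sample_le hdx hK (fun _ => rfl) hk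
  have sN : ∀ m ≤ M, ∀ k ∈ Finset.Icc (1 : ℤ) (K : ℤ), ‖sample dt dx N m k‖ ≤ cN
      ∧ ‖dxPlus dx (sample dt dx N m) k‖ ≤ cN := fun m hm k hk =>
    (bN _ (hmem hm)).norm_sample_le hdx hK (fun _ => rfl) hk
  have sV : ∀ m ≤ M, ∀ k ∈ Finset.Icc (1 : ℤ) (K : ℤ), ‖sample dt dx V m k‖ ≤ cV
      ∧ ‖dxPlus dx (sample dt dx V m) k‖ ≤ cV := fun m hm k hk =>
    (bV _ (hmem hm)).norm_sample_le hdx hK (fun _ => rfl) hk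
  have hquot : ∀ {G : Type} [NormedAddCommGroup G] [NormedSpace ℝ G] {f : ℝ → ℝ → G} {c : ℝ},
      (∀ s t : ℝ, 0 ≤ s → s ≤ t → t ≤ T → ∀ x, |x| ≤ 2 * L → ‖f t x - f s x‖ ≤ c * (t - s)) →
      ∀ m < M, ∀ k ∈ Finset.Icc (1 : ℤ) (K : ℤ), ‖dtPlus dt (sample dt dx f) m k‖ ≤ c := by
    intro G _ _ f c hf m hm k hk
    rw [Finset.mem_Icc] at hk
    have k1 : (1 : ℝ) ≤ k := by exact_mod_cast hk.1
    have k2 : (k : ℝ) ≤ K := by exact_mod_cast hk.2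
    have b2 : k * dx ≤ L := by rw [← hK]; gcongr
    have b1 : 0 ≤ k * dx := by positivity
    have := hf (m * dt) ((m + 1 : ℕ) * dt) (hmem hm.le).1 (by push_cast; linarith) (hmem hm).2
      (k * dx) (by rw [abs_of_nonneg b1]; linarith)
    rw [dtPlus, norm_smul, norm_inv, Real.norm_of_nonneg hdt.le, inv_mul_le_iff₀ hdt]
    refine this.trans (le_of_eq ?_)
    push_cast; ring
  obtain ⟨hmass, henergy⟩ := initial_mass_energy_le (u := Eₕ 0) (ν := Nₕ 0) hdx hdxL hK
    (by rw [hE0]; exact sE 0 (Nat.zero_le _))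
    (by rw [hN0]; exact fun k hk => (sN 0 (Nat.zero_le _) k hk).1)
    (fun k hk => (sV 0 (Nat.zero_le _) k hk).2) hV0
  have hsup : ∀ m ≤ M, ∀ k ∈ Finset.Icc (1 : ℤ) (K : ℤ), ‖Eₕ m k‖ ≤ √S := fun m hm k hk =>
    Real.le_sqrt_of_sq_le (sq_norm_le_of_steps hdx hdt hKpos hK hD.periodic_E
      (fun m hm => hD.isPerturbedStep_zero hm) hmass henergy m hm k hk)
  have hsupe : ∀ m ≤ M, ∀ k ∈ Finset.Icc (1 : ℤ) (K : ℤ), ‖(Eₕ - sample dt dx E) m k‖ ≤ B := by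
    intro m hm k hk
    refine (norm_sub_le _ _).trans ?_
    linarith [hsup m hm k hk, (sE m hm k hk).1]
  have hEB : ∀ m ≤ M, ∀ k ∈ Finset.Icc (1 : ℤ) (K : ℤ), ‖sample dt dx E m k‖ ≤ B :=
    fun m hm k hk => (sE m hm k hk).1.trans (by linarith)
  have hNB : ∀ m ≤ M, ∀ k ∈ Finset.Icc (1 : ℤ) (K : ℤ), ‖sample dt dx N m k‖ ≤ B :=
    fun m hm k hk => (sN m hm k hk).1.trans (by linarith)
  set Φ : ℕ → ℝ := fun m => lyapunov dx K B ((Eₕ - sample dt dx E) m) (sample dt dx E m)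
    ((Nₕ - sample dt dx N) m) ((Vₕ - sample dt dx V) m) (sample dt dx N m) with hΦ
  have hcoer : ∀ m ≤ M, meshSum dx K (errorDensity dx ((Eₕ - sample dt dx E) m)
      ((Nₕ - sample dt dx N) m) ((Vₕ - sample dt dx V) m)) ≤ 4 * Φ m := fun m hm =>
    errorDensity_le_lyapunov hdx.le hB (hsupe m hm) (hEB m hm) (hNB m hm)
  have hΦ0 : ∀ m ≤ M, 0 ≤ Φ m := fun m hm => by
    have h1 : 0 ≤ meshSum dx K (errorDensity dx ((Eₕ - sample dt dx E) m)
        ((Nₕ - sample dt dx N) m) ((Vₕ - sample dt dx V) m)) :=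
      meshSum_nonneg hdx.le fun k => by unfold errorDensity; positivity
    linarith [hcoer m hm]
  -- Initially the errors in `E` and `N` vanish, so only half the squared gradient of the error in
  -- `V` remains.
  have hstart : Φ 0 ≤ CV ^ 2 / 2 * (dt ^ 2 + dx ^ 2) ^ 2 := by
    have h1 : Φ 0 = 1 / 2 * meshNorm dx K
        (dxPlus dx (fun k => Vₕ 0 k - sample dt dx V 0 k)) ^ 2 := by
      rw [meshNorm_sq hdx.le, ← meshSum_const_mul]
      simp only [hΦ, lyapunov, Pi.sub_apply, hE0, hN0, sub_self]
      have h2 : meshSum dx K (fun _ => ‖(0 : ℂ)‖ ^ 2) = 0 := by simp [meshSum]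
      rw [h2, mul_zero, add_zero]
      congr 1
      funext k
      have h3 : dxPlus dx (0 : ℤ → ℂ) k = 0 := by simp [dxPlus]
      have h4 : dxPlus dx (Vₕ 0 - sample dt dx V 0) k
        = dxPlus dx (fun k => Vₕ 0 k - sample dt dx V 0 k) k := rfl
      simp only [energyDensity, h3, h4, Pi.zero_apply, Complex.zero_re, Complex.zero_im, norm_zero,
        Real.norm_eq_abs, sq_abs]
      ring
    have h2 := pow_le_pow_left₀ (Real.sqrt_nonneg _) hV0 2
    have h3 : (CV * dx ^ 2) ^ 2 ≤ CV ^ 2 * (dt ^ 2 + dx ^ 2) ^ 2 := by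
      rw [mul_pow]
      gcongr
      linarith [sq_nonneg dt]
    rw [h1]
    unfold meshNorm at h2 ⊢
    linarith
  have hstep : ∀ m < M, Φ (m + 1) - Φ m ≤ dt * (120 * B ^ 4) * (Φ (m + 1) + Φ m
      + L * (cR * (dt ^ 2 + dx ^ 2)) ^ 2) := by
    intro m hm
    rw [← hK]
    refine (hD.isPerturbedStep_error hdt.le hM hK hsol hm).lyapunov_sub_le hdx.le hdt hB
      fun k hk => ?_
    obtain ⟨r1, r2, r3, r4⟩ := bR M K dt dx hdt hdx hM hK m hm k hk
    exact ⟨hsupe m hm.le k hk, hsupe _ hm k hk, hEB m hm.le k hk, hEB _ hm k hk,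
      hNB m hm.le k hk, hNB _ hm k hk, (hquot tE m hm k hk).trans (by linarith),
      (hquot tN m hm k hk).trans (by linarith), r1, r3, r2, r4⟩
  have hθ : dt * (120 * B ^ 4) ≤ 1 / 2 := by
    rw [lt_div_iff₀ (by positivity)] at hε
    linarith
  intro m hm
  have hg := discrete_gronwall (by positivity) hθ (by positivity) hΦ0 hstep m hm
  rw [errorFunctional_eq hdx.le]
  refine (hcoer m hm).trans ?_
  have hexp : Real.exp (4 * (dt * (120 * B ^ 4)) * m) ≤ Real.exp (480 * B ^ 4 * T) := by
    rw [Real.exp_le_exp]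
    have := mul_le_mul_of_nonneg_left (hmem hm).2 (show 0 ≤ 480 * B ^ 4 by positivity)
    linarith
  have hsum : Φ 0 + L * (cR * (dt ^ 2 + dx ^ 2)) ^ 2
      ≤ (CV ^ 2 / 2 + L * cR ^ 2) * (dt ^ 2 + dx ^ 2) ^ 2 := by linarith
  have hfin := hg.trans (mul_le_mul hexp hsum
    (add_nonneg (hΦ0 0 (Nat.zero_le _)) (by positivity)) (Real.exp_pos _).le)
  linarith

end Zakharov

end

theorem theorem3p3 (T L : ℝ) (hT : 0 < T) (hL : 0 < L)
    (E : ℝ → ℝ → ℂ) (N V : ℝ → ℝ → ℝ)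
    (hsol : Zakharov.IsSolution T L E N V)
    (hE : Zakharov.SmoothOnStrip 5 T E) (hN : Zakharov.SmoothOnStrip 5 T N)
    (hV : Zakharov.SmoothOnStrip 5 T V)
    (CV : ℝ) :
    ∃ C : ℝ, 0 < C ∧ ∃ ε : ℝ, 0 < ε ∧ ∀ M K : ℕ, 0 < M → 0 < K → ∀ dt dx : ℝ, dt = T / M → dx = L / K →
      dt < ε → dx < ε →
      ∀ (Eₕ : ℕ → ℤ → ℂ) (Nₕ Vₕ : ℕ → ℤ → ℝ),
        Zakharov.IsDVDM dt dx M K Eₕ Nₕ Vₕ →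
        (∀ k, Eₕ 0 k = E 0 (k * dx)) →
        (∀ k, Nₕ 0 k = N 0 (k * dx)) →
        -- the initial value of `V` is second order accurate in the discrete gradient norm
        Zakharov.meshNorm dx K
          (Zakharov.dxPlus dx (fun k : ℤ => Vₕ 0 k - V 0 (k * dx))) ≤ CV * dx ^ 2 →
        ∀ m ≤ M, ∀ (eE : ℤ → ℂ) (eN eV : ℤ → ℝ),
          eE = Eₕ m - Zakharov.sample dt dx E m →
          eN = Nₕ m - Zakharov.sample dt dx N m →
          eV = Vₕ m - Zakharov.sample dt dx V m →
          Zakharov.errorFunctional dx K eE eN eV ≤ C ^ 2 * (dt ^ 2 + dx ^ 2) ^ 2 ∧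
          Zakharov.meshNorm dx K eE ≤ C * (dt ^ 2 + dx ^ 2) ∧
          Zakharov.meshNorm dx K (Zakharov.dxPlus dx eE) ≤ C * (dt ^ 2 + dx ^ 2) ∧
          Zakharov.meshNorm dx K eN ≤ C * (dt ^ 2 + dx ^ 2) ∧
          Zakharov.meshNorm dx K (Zakharov.dxPlus dx eV) ≤ C * (dt ^ 2 + dx ^ 2) := by
  obtain ⟨D, hD, ε, hε, h⟩ := hsol.exists_errorFunctional_le hT hL hE hN hV CV
  -- The choice `1 + D` is positive and satisfies `D ≤ (1 + D) ^ 2`, so no square root of `D` is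
  -- needed.
  refine ⟨1 + D, by positivity, ε, hε, ?_⟩
  intro M K hM hK dt dx hdt hdx hdtε _ Eₕ Nₕ Vₕ hscheme hE0 hN0 hV0 m hm eE eN eV hEe hNe hVe
  have hM' : (0 : ℝ) < M := by exact_mod_cast hM
  have hK' : (0 : ℝ) < K := by exact_mod_cast hK
  have hs : ∀ {F : Type} [NormedAddCommGroup F] [NormedSpace ℝ F] (f : ℝ → ℝ → F) (k : ℤ),
      Zakharov.sample dt dx f 0 k = f 0 (k * dx) := fun f k => by
    simp [Zakharov.sample]
  have key := h M K dt dx (by rw [hdt]; positivity) (by rw [hdx]; positivity)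
    (by rw [hdt]; field_simp) (by rw [hdx]; field_simp) hdtε Eₕ Nₕ Vₕ hscheme
    (funext fun k => by rw [hE0, hs]) (funext fun k => by rw [hN0, hs])
    (by simpa only [hs] using hV0) m hm
  rw [← hEe, ← hNe, ← hVe] at key
  have hC : Zakharov.errorFunctional dx K eE eN eV ≤ (1 + D) ^ 2 * (dt ^ 2 + dx ^ 2) ^ 2 :=
    key.trans (mul_le_mul_of_nonneg_right (by nlinarith) (by positivity))
  have hnorm : ∀ y : ℝ, y ^ 2 ≤ Zakharov.errorFunctional dx K eE eN eV →
      y ≤ (1 + D) * (dt ^ 2 + dx ^ 2) := fun y hy =>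
    le_of_abs_le (abs_le_of_sq_le_sq (by rw [mul_pow]; exact hy.trans hC) (by positivity))
  refine ⟨hC, hnorm _ ?_, hnorm _ ?_, hnorm _ ?_, hnorm _ ?_⟩ <;>
  · unfold Zakharov.errorFunctional
    linarith [sq_nonneg (Zakharov.meshNorm dx K eE), sq_nonneg (Zakharov.meshNorm dx K eN),
      sq_nonneg (Zakharov.meshNorm dx K (Zakharov.dxPlus dx eE)),
      sq_nonneg (Zakharov.meshNorm dx K (Zakharov.dxPlus dx eV))]
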